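/- In the cell-probe model, memory consists of cells of $w$ bits, addressed by $w$-bit words, where $w\ge\log_2 n$; reading or writing one cell costs one probe, all other computation is free, and nothing but the memory is kept between operations (the initial memory contents are arbitrary). In the online Hamming distance problem for a fixed string $F\in\Sigma^n$, an initial string $S_0\in\Sigma^n$ is known in advance, symbols of $\Sigma$ then arrive one at a time, and after each arrival, before the next one, the algorithm must output the Hamming distance between $F$ and the last $n$ symbols of the stream. **Theorem.** There is an absolute constant $c>0$ such that the following holds for all positive integers $n,\delta$ with $n\ge(2^\delta-1)^2$ and an alphabet $\Sigma$ with $|\Sigma|=2^\delta$. There are a string $F\in\Sigma^n$ and a probability distribution $\mu$ on update sequences in $\Sigma^n$ such that, for every integer $w\ge\log_2 n$ (if $n=1$ and $w=0$, read the bounds below as $0$) and every initial string $S_0\in\Sigma^n$: 1. every deterministic cell-probe algorithm with $w$-bit cells that solves the online Hamming distance problem for $F$ and $S_0$ makes, on $n$ arrivals drawn from $\mu$, an expected average of at least $c\,\frac{\delta}{w}\log_2 n$ cell probes per arriving symbol; 2. for every randomised cell-probe algorithm with $w$-bit cells (a probability distribution over deterministic algorithms that solve the problem for $F$ and $S_0$)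 there is an update sequence $U\in\Sigma^n$ on which the expected number of cell probes, averaged over the $n$ arrivals, is at least $c\,\frac{\delta}{w}\log_2 n$ per arriving symbol. -/

import Mathlib

open scoped ENNReal

namespace CellProbe

/-- The memory of the cell-probe model: cells of `w` bits, addressed by `w`-bit words (so a cell can
hold the address of any cell). -/
abbrev Memory (w : ℕ) : Type := BitVec w → BitVec w

/-- The computation triggered by one operation, as an adaptive sequence of cell probes.
Computation between probes is free: each next step may depend arbitrarily on everything
that has been read so far in this operation. -/
inductive Program (w : ℕ) (α : Type) : Type
  | ret (a : α) : Program w α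
  | read (addr : BitVec w) (next : BitVec w → Program w α) : Program w α
  | write (addr : BitVec w) (value : BitVec w) (next : Program w α) : Program w α

/-- Running a program on a memory: the returned value, the new memory, and the number of
cell probes (reads and writes both cost one). -/
def Program.run {w : ℕ} {α : Type} : Program w α → Memory w → α × Memory w × ℕ
  | .ret a, M => (a, M, 0)
  | .read addr next, M =>
      let p := (next (M addr)).run M
      (p.1, p.2.1, p.2.2 + 1)
  | .write addr value next, M =>
      let p := next.run (Function.update M addr value)
      (p.1, p.2.1, p.2.2 + 1)

/-- A deterministic online cell-probe algorithm processing `m` arrivals of symbols from `σ`: an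
initial memory (arbitrary preprocessing is free) and, for each arrival, a program depending only
on the arriving symbol. Nothing but the memory is carried over between arrivals. The program may
also depend on the index of the arrival; this only enlarges the class of algorithms, and makes a
randomised algorithm using fresh coins at each arrival a mixture of deterministic ones. -/
structure Algorithm (w : ℕ) (σ : Type) (m : ℕ) : Type where
  init : Memory w
  op : Fin m → σ → Program w ℕ

namespace Algorithm

variable {w m : ℕ} {σ : Type}

/-- The memory just before arrival number `t` (counted from `0`) on the update sequence `U`. -/
def memoryAt (A : Algorithm w σ m) (U : Fin m → σ) : ℕ → Memory w
  | 0 => A.init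
  | t + 1 =>
      if h : t < m then ((A.op ⟨t, h⟩ (U ⟨t, h⟩)).run (A.memoryAt U t)).2.1
      else A.memoryAt U t

/-- The number output at arrival `t`. -/
def output (A : Algorithm w σ m) (U : Fin m → σ) (t : Fin m) : ℕ :=
  ((A.op t (U t)).run (A.memoryAt U t)).1

/-- The number of cell probes made at arrival `t`. -/
def probes (A : Algorithm w σ m) (U : Fin m → σ) (t : Fin m) : ℕ :=
  ((A.op t (U t)).run (A.memoryAt U t)).2.2

/-- The total number of cell probes over all `m` arrivals. -/
def totalProbes (A : Algorithm w σ m) (U : Fin m → σ) : ℕ :=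
  ∑ t, A.probes U t

end Algorithm

/-- The last `n` symbols of the stream just after the arrival of `U t`, where the stream starts
with the string `S₀` of length `n`, followed by the arriving symbols `U 0, U 1, …`. -/
def window {n m : ℕ} {σ : Type} (S₀ : Fin n → σ) (U : Fin m → σ) (t : Fin m) : Fin n → σ :=
  fun i => Fin.append S₀ U ⟨t + 1 + i, by omega⟩

/-- `A` solves the online Hamming distance problem for the fixed string `F` and the initial
string `S₀`: on every update sequence, each arrival is answered by the Hamming distance between
`F` and the last `n` symbols of the stream. -/
def Algorithm.SolvesHamming {w n m : ℕ} {σ : Type} [DecidableEq σ] (A : Algorithm w σ m)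
    (F S₀ : Fin n → σ) : Prop :=
  ∀ (U : Fin m → σ) (t : Fin m), A.output U t = hammingDist F (window S₀ U t)

/-- Expected amortised number of cell probes per arrival of a deterministic algorithm, when the
update sequence is drawn from `μ`. -/
noncomputable def amortisedProbes {w m : ℕ} {σ : Type} (A : Algorithm w σ m)
    (μ : PMF (Fin m → σ)) : ℝ≥0∞ :=
  (∑' U, μ U * (A.totalProbes U : ℝ≥0∞)) / m

/-- Expected amortised number of cell probes per arrival of a randomised algorithm, i.e. a
probability distribution over deterministic ones, on the fixed update sequence `U`. (For a finite
alphabet there are only countably many deterministic algorithms, so `PMF` covers all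
distributions.) -/
noncomputable def randomisedAmortisedProbes {w m : ℕ} {σ : Type} (ν : PMF (Algorithm w σ m))
    (U : Fin m → σ) : ℝ≥0∞ :=
  (∑' A, ν A * (A.totalProbes U : ℝ≥0∞)) / m

end CellProbe

/-!
The proof uses the information transfer method. For a pair of adjacent time intervals, the outputs
in the right interval depend on the symbols that arrived in the left one only through the cells
that are changed in the left interval and read, while still unchanged, in the right one
(`Algorithm.output_eq_of_transferData_eq`). If the outputs in the right interval determine `B` bits
of the left one, then on average about `B / (2 * w)` cells are transferred, since a cell is
described by an address and a content of `w` bits each (`Algorithm.le_sum_card_transfer`). The pairs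
of intervals are taken from the levels of a binary tree over the arrivals, where every read is
charged to at most one pair (`Algorithm.sum_card_transfer_le`). A bound of order `δ * K` bits for
intervals of length `K`, on a constant fraction of the `log n` levels, gives the theorem.

It remains to find a string `F` and a distribution such that the outputs in a right interval carry
that much information: a constant fraction of `δ` bits per output. The construction is explicit.
Lindström's detecting matrix, adapted to unknowns with many values, determines `R` unknowns, at
least half of which take `R ^ Ω(1)` values, from `R` sums of equality tests (`exists_detecting`). Its rows have to be
realised by shifts of one pattern. To this end each unknown has its own part of the alphabet, so
that the answers for the unknown `r` can be stored in the pattern at a distance that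
compensates for the position of this unknown within its row, and the first `R` outputs of every
row answer the queries about one set of `R` unknowns, with no interference between different sets
(`exists_large_slidingCode`). Only `2 ^ Ω(δ)` of the symbols are used, so that the length of this
pattern is at most a small power of `n`. In `F` a copy of the pattern begins at every age
`L * 2 ^ k`, where `L` is the row length, and all other symbols are a null symbol
(`SlidingCode.fixedString`). At the level of the tree with intervals of `2 ^ k` rows only this copy
meets the first quarter of the left interval (`SlidingCode.rows_eq_of_hammingDist_eq`). The
distribution is uniform over sequences of encoded rows.

For `n` below an absolute constant, it suffices that an algorithm without any probe fails
(`one_le_totalProbes_add`). The randomised bound follows by averaging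
(`exists_le_randomisedAmortisedProbes`).
-/

namespace CellProbe

/-! ### Information transfer between two time intervals -/

/-- The addresses read while a program runs on the memory `M`. -/
def Program.reads {w : ℕ} {α : Type} : Program w α → Memory w → Finset (BitVec w)
  | .ret _, _ => ∅
  | .read addr next, M => insert addr ((next (M addr)).reads M)
  | .write addr value next, M => next.reads (Function.update M addr value)

theorem Program.card_reads_le {w : ℕ} {α : Type} (p : Program w α) (M : Memory w) :
    (p.reads M).card ≤ (p.run M).2.2 := by
  induction p generalizing M with
  | ret a => simp [reads]
  | read addr next ih =>
    simp only [reads, run]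
    exact (Finset.card_insert_le _ _).trans (Nat.succ_le_succ (ih _ _))
  | write addr value next ih =>
    simp only [reads, run]
    exact (ih _).trans (Nat.le_succ _)

/-- Two memories that agree on the addresses read in both runs cannot be told apart: the outputs
coincide, and afterwards every cell either has the same content in both memories or has kept its
content in both. -/
theorem Program.run_congr {w : ℕ} {α : Type} (p : Program w α) (M N : Memory w)
    (h : ∀ a ∈ p.reads M, a ∈ p.reads N → M a = N a) :
    (p.run M).1 = (p.run N).1 ∧ ∀ a, (p.run M).2.1 a = (p.run N).2.1 a ∨
      ((p.run M).2.1 a = M a ∧ (p.run N).2.1 a = N a) := by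
  induction p generalizing M N with
  | ret a => simp [run]
  | read addr next ih =>
    have h0 : M addr = N addr := h addr (by simp [reads]) (by simp [reads])
    simp only [run]
    rw [← h0]
    refine ih _ M N fun a ha ha' => h a ?_ ?_
    · simp [reads, ha]
    · simp [reads, ← h0, ha']
  | write addr value next ih =>
    simp only [run]
    have := ih (Function.update M addr value) (Function.update N addr value) (by
      intro a ha ha'
      by_cases hE : a = addr
      · simp [hE]
      · simpa [Function.update_of_ne hE] using h a ha ha')
    refine ⟨this.1, fun a => ?_⟩
    by_cases hE : a = addr
    · left
      rcases this.2 a with h' | h'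
      · exact h'
      · rw [h'.1, h'.2, hE]; simp
    · simpa [Function.update_of_ne hE] using this.2 a

namespace Algorithm

variable {w m : ℕ} {σ : Type}

/-- The addresses read at arrival `t`. -/
def reads (A : Algorithm w σ m) (U : Fin m → σ) (t : Fin m) : Finset (BitVec w) :=
  (A.op t (U t)).reads (A.memoryAt U t)

theorem memoryAt_succ (A : Algorithm w σ m) (U : Fin m → σ) (t : Fin m) :
    A.memoryAt U (t + 1) = ((A.op t (U t)).run (A.memoryAt U t)).2.1 := by
  simp [memoryAt]

theorem memoryAt_congr (A : Algorithm w σ m) {U V : Fin m → σ} {t : ℕ}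
    (h : ∀ i : Fin m, (i : ℕ) < t → U i = V i) : A.memoryAt U t = A.memoryAt V t := by
  induction t with
  | zero => rfl
  | succ t ih =>
    have := ih fun i hi => h i (by omega)
    by_cases ht : t < m
    · simp [memoryAt, ht, this, h ⟨t, ht⟩ (by simp)]
    · simp [memoryAt, ht, this]

open Classical in
/-- The cells through which information flows from the arrivals in `[p₀, p₁)` to the arrivals in
`[p₁, p₂)`: their content changes between `p₀` and `p₁`, and they are read at some arrival in
`[p₁, p₂)` up to which the content they had at `p₁` has been kept. In contrast to the usual
definition through write operations, only contents are compared. -/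
noncomputable def transfer (A : Algorithm w σ m) (U : Fin m → σ) (p₀ p₁ p₂ : ℕ) :
    Finset (BitVec w) :=
  Finset.univ.filter fun a => A.memoryAt U p₀ a ≠ A.memoryAt U p₁ a ∧
    ∃ t : Fin m, p₁ ≤ t ∧ t < p₂ ∧ a ∈ A.reads U t ∧
      ∀ τ, p₁ ≤ τ → τ ≤ t → A.memoryAt U τ a = A.memoryAt U p₁ a

/-- The transferred cells together with their contents at time `p₁`. -/
noncomputable def transferData (A : Algorithm w σ m) (U : Fin m → σ) (p₀ p₁ p₂ : ℕ) :
    Finset (BitVec w × BitVec w) :=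
  (A.transfer U p₀ p₁ p₂).image fun a => (a, A.memoryAt U p₁ a)

theorem card_transferData (A : Algorithm w σ m) (U : Fin m → σ) (p₀ p₁ p₂ : ℕ) :
    (A.transferData U p₀ p₁ p₂).card = (A.transfer U p₀ p₁ p₂).card :=
  Finset.card_image_of_injective _ fun _ _ h => (Prod.mk.inj h).1

theorem mem_transferData (A : Algorithm w σ m) (U : Fin m → σ) (p₀ p₁ p₂ : ℕ)
    (x : BitVec w × BitVec w) :
    x ∈ A.transferData U p₀ p₁ p₂ ↔ x.1 ∈ A.transfer U p₀ p₁ p₂ ∧ A.memoryAt U p₁ x.1 = x.2 := by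
  constructor
  · intro h
    obtain ⟨a, ha, rfl⟩ := Finset.mem_image.1 h
    exact ⟨ha, rfl⟩
  · rintro ⟨h, h'⟩
    exact Finset.mem_image.2 ⟨x.1, h, by rw [h']⟩

/-- For update sequences that differ only in `[p₀, p₁)`, the outputs in `[p₁, p₂)` are determined
by the transferred cells and their contents. -/
theorem output_eq_of_transferData_eq (A : Algorithm w σ m) {U V : Fin m → σ} {p₀ p₁ p₂ : ℕ}
    (hUV : ∀ i : Fin m, (i : ℕ) < p₀ ∨ p₁ ≤ i → U i = V i)
    (hE : A.transferData U p₀ p₁ p₂ = A.transferData V p₀ p₁ p₂)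
    (t : Fin m) (ht₁ : p₁ ≤ t) (ht₂ : (t : ℕ) < p₂) : A.output U t = A.output V t := by
  have h₀ : A.memoryAt U p₀ = A.memoryAt V p₀ := A.memoryAt_congr fun i hi => hUV i (Or.inl hi)
  have hmem : ∀ a, a ∈ A.transfer U p₀ p₁ p₂ ↔ a ∈ A.transfer V p₀ p₁ p₂ := by
    intro a
    constructor
    · intro h
      have := (A.mem_transferData U p₀ p₁ p₂ (a, A.memoryAt U p₁ a)).2 ⟨h, rfl⟩
      rw [hE] at this
      exact ((A.mem_transferData V p₀ p₁ p₂ _).1 this).1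
    · intro h
      have := (A.mem_transferData V p₀ p₁ p₂ (a, A.memoryAt V p₁ a)).2 ⟨h, rfl⟩
      rw [← hE] at this
      exact ((A.mem_transferData U p₀ p₁ p₂ _).1 this).1
  have hval : ∀ a ∈ A.transfer U p₀ p₁ p₂, A.memoryAt U p₁ a = A.memoryAt V p₁ a := by
    intro a h
    have := (A.mem_transferData U p₀ p₁ p₂ (a, A.memoryAt U p₁ a)).2 ⟨h, rfl⟩
    rw [hE] at this
    exact ((A.mem_transferData V p₀ p₁ p₂ _).1 this).2.symm
  -- A cell that differs is not transferred and has kept its content since `p₁` in both runs.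
  set Inv : ℕ → Prop := fun t => ∀ a, A.memoryAt U t a = A.memoryAt V t a ∨
    (a ∉ A.transfer U p₀ p₁ p₂ ∧ ∀ τ, p₁ ≤ τ → τ ≤ t →
      A.memoryAt U τ a = A.memoryAt U p₁ a ∧ A.memoryAt V τ a = A.memoryAt V p₁ a) with hInv
  have key : ∀ t : Fin m, p₁ ≤ t → (t : ℕ) < p₂ → Inv t →
      A.output U t = A.output V t ∧ Inv (t + 1) := by
    intro t ht₁ ht₂ hI
    have hag : ∀ a ∈ A.reads U t, a ∈ A.reads V t → A.memoryAt U t a = A.memoryAt V t a := by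
      intro a hU hV
      rcases hI a with h | ⟨hn, hc⟩
      · exact h
      have hU' : A.memoryAt U p₀ a = A.memoryAt U p₁ a := by
        by_contra hne
        exact hn (by
          simp only [transfer, Finset.mem_filter, Finset.mem_univ, true_and]
          exact ⟨hne, t, ht₁, ht₂, hU, fun τ h1 h2 => (hc τ h1 h2).1⟩)
      have hV' : A.memoryAt V p₀ a = A.memoryAt V p₁ a := by
        by_contra hne
        exact hn ((hmem a).2 (by
          simp only [transfer, Finset.mem_filter, Finset.mem_univ, true_and]
          exact ⟨hne, t, ht₁, ht₂, hV, fun τ h1 h2 => (hc τ h1 h2).2⟩))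
      rw [(hc t ht₁ le_rfl).1, (hc t ht₁ le_rfl).2, ← hU', ← hV', h₀]
    have hUt : U t = V t := hUV t (Or.inr ht₁)
    have hr := Program.run_congr (A.op t (U t)) (A.memoryAt U t) (A.memoryAt V t) (by
      intro a h1 h2
      exact hag a h1 (by rw [hUt] at h2; exact h2))
    refine ⟨?_, fun a => ?_⟩
    · unfold output
      rw [hr.1, hUt]
    · rw [memoryAt_succ, memoryAt_succ]
      rcases hr.2 a with h | h
      · left
        rw [h, hUt]
      · rcases hI a with h' | ⟨hn, hc⟩
        · left
          rw [h.1, ← hUt, h.2, h']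
        · refine Or.inr ⟨hn, fun τ h1 h2 => ?_⟩
          rcases Nat.lt_or_ge (t : ℕ) τ with h3 | h3
          · have : τ = t + 1 := by omega
            subst this
            rw [memoryAt_succ, memoryAt_succ, h.1, ← hUt, h.2]
            exact hc t ht₁ le_rfl
          · exact hc τ h1 h3
  have hI : ∀ s, p₁ ≤ s → s ≤ t → Inv s := by
    intro s hs
    induction s, hs using Nat.le_induction with
    | base =>
      intro _ a
      by_cases ha : a ∈ A.transfer U p₀ p₁ p₂
      · exact Or.inl (hval a ha)
      · exact Or.inr ⟨ha, fun τ h1 h2 => by rw [le_antisymm h2 h1]; exact ⟨rfl, rfl⟩⟩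
    | succ s hs ih =>
      intro hst
      exact (key ⟨s, by omega⟩ hs (show s < p₂ by omega) (ih (by omega))).2
  exact (key t ht₁ ht₂ (hI t ht₁ le_rfl)).1

/-- If the pairs of adjacent intervals are nested in such a way that two pairs whose right
intervals meet have one left interval inside the time span of the other right interval, then each
read is charged to at most one pair. -/
theorem sum_card_transfer_le (A : Algorithm w σ m) (U : Fin m → σ) {ι : Type*} (I : Finset ι)
    (p₀ p₁ p₂ : ι → ℕ) (hp : ∀ i, p₀ i ≤ p₁ i)
    (hI : ∀ i ∈ I, ∀ j ∈ I, i ≠ j → ∀ t, p₁ i ≤ t → t < p₂ i → p₁ j ≤ t → t < p₂ j →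
      p₁ i ≤ p₀ j ∨ p₁ j ≤ p₀ i) :
    ∑ i ∈ I, (A.transfer U (p₀ i) (p₁ i) (p₂ i)).card ≤ A.totalProbes U := by
  classical
  rcases isEmpty_or_nonempty (Fin m) with hm | hm
  · simp [transfer]
  have hwit : ∀ x : (_ : ι) × BitVec w, x ∈ I.sigma (fun i => A.transfer U (p₀ i) (p₁ i) (p₂ i)) →
      ∃ t : Fin m, p₁ x.1 ≤ t ∧ t < p₂ x.1 ∧ x.2 ∈ A.reads U t ∧
        ∀ τ, p₁ x.1 ≤ τ → τ ≤ t → A.memoryAt U τ x.2 = A.memoryAt U (p₁ x.1) x.2 := by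
    intro x hx
    have := (Finset.mem_sigma.1 hx).2
    simp only [transfer, Finset.mem_filter, Finset.mem_univ, true_and] at this
    exact this.2
  have hne : ∀ x : (_ : ι) × BitVec w, x ∈ I.sigma (fun i => A.transfer U (p₀ i) (p₁ i) (p₂ i)) →
      A.memoryAt U (p₀ x.1) x.2 ≠ A.memoryAt U (p₁ x.1) x.2 := by
    intro x hx
    have := (Finset.mem_sigma.1 hx).2
    simp only [transfer, Finset.mem_filter, Finset.mem_univ, true_and] at this
    exact this.1
  choose! f hf using hwit
  calc ∑ i ∈ I, (A.transfer U (p₀ i) (p₁ i) (p₂ i)).card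
      = (I.sigma (fun i => A.transfer U (p₀ i) (p₁ i) (p₂ i))).card := by rw [Finset.card_sigma]
    _ ≤ (Finset.univ.sigma (fun t => A.reads U t)).card := by
        refine Finset.card_le_card_of_injOn (fun x => (⟨f x, x.2⟩ : (_ : Fin m) × BitVec w)) ?_ ?_
        · intro x hx
          exact Finset.mem_coe.2 (Finset.mem_sigma.2 ⟨Finset.mem_univ _, (hf x hx).2.2.1⟩)
        · rintro ⟨i, a⟩ hx ⟨j, b⟩ hy hxy
          have h1 : f ⟨i, a⟩ = f ⟨j, b⟩ := congrArg Sigma.fst hxy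
          have h2 : a = b := by simpa using congrArg Sigma.snd hxy
          subst h2
          by_contra hcon
          have hij : i ≠ j := fun h => hcon (by rw [h])
          obtain ⟨i1, i2, -, i4⟩ := hf _ hx
          obtain ⟨j1, j2, -, j4⟩ := hf _ hy
          rw [← h1] at j1 j2 j4
          simp only at i1 i2 i4 j1 j2 j4
          rcases hI i (Finset.mem_sigma.1 hx).1 j (Finset.mem_sigma.1 hy).1 hij _ i1 i2 j1 j2
            with h | h
          · have hj := hp j
            exact hne _ hy ((i4 (p₀ j) h (by omega)).trans (i4 (p₁ j) (by omega) j1).symm)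
          · have hi := hp i
            exact hne _ hx ((j4 (p₀ i) h (by omega)).trans (j4 (p₁ i) (by omega) i1).symm)
    _ = ∑ t, (A.reads U t).card := by rw [Finset.card_sigma]
    _ ≤ A.totalProbes U := Finset.sum_le_sum fun t _ => Program.card_reads_le _ _

end Algorithm

/-- A counting form of Shannon's bound: distinct finite subsets of a type with `a` elements have
average size at least `(log N - 2) / log a`, where `N` is their number. It holds since the weights
`a ^ (-|S|)` of all subsets add up to `(1 + 1 / a) ^ a`, which is less than `3`. -/
theorem le_sum_card_of_injective {Θ α : Type*} [Fintype Θ] [Nonempty Θ] [Fintype α] [Nonempty α]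
    [DecidableEq α] (f : Θ → Finset α) (hf : Function.Injective f) :
    (Fintype.card Θ : ℝ) * (Real.log (Fintype.card Θ) - 2) ≤
      Real.log (Fintype.card α) * ∑ θ, ((f θ).card : ℝ) := by
  set N : ℝ := (Fintype.card Θ : ℝ)
  set a : ℝ := (Fintype.card α : ℝ)
  have hN : 0 < N := by simp only [N]; exact_mod_cast Fintype.card_pos
  have ha : 0 < a := by simp only [a]; exact_mod_cast Fintype.card_pos
  have h1 : ∑ θ, (a⁻¹) ^ (f θ).card ≤ 3 := by
    calc ∑ θ, (a⁻¹) ^ (f θ).card = ∑ S ∈ Finset.univ.image f, (a⁻¹) ^ S.card := by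
          rw [Finset.sum_image fun _ _ _ _ h => hf h]
      _ ≤ ∑ S : Finset α, (a⁻¹) ^ S.card :=
          Finset.sum_le_sum_of_subset_of_nonneg (Finset.subset_univ _) fun _ _ _ => by positivity
      _ = (a⁻¹ + 1) ^ Fintype.card α := by
          rw [← Finset.card_univ, ← Finset.sum_pow_mul_eq_add_pow]
          simp
      _ ≤ (Real.exp a⁻¹) ^ Fintype.card α :=
          pow_le_pow_left₀ (by positivity) (Real.add_one_le_exp _) _
      _ = Real.exp 1 := by
          rw [← Real.exp_nat_mul, mul_inv_cancel₀ ha.ne']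
      _ ≤ 3 := Real.exp_one_lt_d9.le.trans (by norm_num)
  have h2 : ∀ θ, 1 - (f θ).card * Real.log a + Real.log N ≤ N * (a⁻¹) ^ (f θ).card := by
    intro θ
    have := Real.add_one_le_exp (Real.log N - (f θ).card * Real.log a)
    rw [Real.exp_sub, Real.exp_log hN, Real.exp_nat_mul, Real.exp_log ha] at this
    rw [inv_pow, ← div_eq_mul_inv]
    linarith
  have h3 := Finset.sum_le_sum fun θ (_ : θ ∈ Finset.univ) => h2 θ
  rw [← Finset.mul_sum] at h3
  have h4 : ∑ θ, (1 - ((f θ).card : ℝ) * Real.log a + Real.log N)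
      = N * (1 + Real.log N) - Real.log a * ∑ θ, ((f θ).card : ℝ) := by
    rw [Finset.sum_add_distrib, Finset.sum_sub_distrib, ← Finset.sum_mul]
    simp only [Finset.sum_const, Finset.card_univ, nsmul_eq_mul]
    ring
  rw [h4] at h3
  nlinarith

/-- Information transfer bound: if the update sequences of a family differ only in `[p₀, p₁)` and
are told apart by the outputs in `[p₁, p₂)`, then on average many cells are transferred. -/
theorem Algorithm.le_sum_card_transfer {w m : ℕ} {σ : Type} (A : Algorithm w σ m) {Θ : Type*}
    [Fintype Θ] [Nonempty Θ] (U : Θ → Fin m → σ) (p₀ p₁ p₂ : ℕ)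
    (hU : ∀ θ θ', ∀ i : Fin m, (i : ℕ) < p₀ ∨ p₁ ≤ i → U θ i = U θ' i)
    (hinj : ∀ θ θ', (∀ t : Fin m, p₁ ≤ t → (t : ℕ) < p₂ → A.output (U θ) t = A.output (U θ') t) →
      θ = θ') :
    (Fintype.card Θ : ℝ) * (Real.log (Fintype.card Θ) - 2) ≤
      2 * w * Real.log 2 * ∑ θ, ((A.transfer (U θ) p₀ p₁ p₂).card : ℝ) := by
  have hc : ∀ v, Fintype.card (BitVec v) = 2 ^ v := by
    intro v
    rw [Fintype.card_congr BitVec.equivFin.toEquiv, Fintype.card_fin]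
  have := le_sum_card_of_injective (fun θ => A.transferData (U θ) p₀ p₁ p₂) (by
    intro θ θ' h
    exact hinj θ θ' (A.output_eq_of_transferData_eq (hU θ θ') h))
  simp only [card_transferData, Fintype.card_prod, hc] at this
  refine this.trans (le_of_eq ?_)
  push_cast
  rw [← pow_add, Real.log_pow]
  push_cast
  ring


/-! ### A detecting family of queries -/

theorem two_mul_card_even_powerset {ι : Type*} [DecidableEq ι] {A : Finset ι} (hA : A.Nonempty) :
    2 * (A.powerset.filter fun C : Finset ι => Even C.card).card = 2 ^ A.card := by
  have h1 := Finset.sum_powerset_neg_one_pow_card_of_nonempty hA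
  rw [← Finset.sum_filter_add_sum_filter_not A.powerset fun C : Finset ι => Even C.card] at h1
  have h2 : ∑ C ∈ A.powerset with Even C.card, (-1 : ℤ) ^ C.card =
      ((A.powerset.filter fun C : Finset ι => Even C.card).card : ℤ) := by
    rw [Finset.sum_congr rfl fun C hC => (Finset.mem_filter.1 hC).2.neg_one_pow]
    simp
  have h3 : ∑ C ∈ A.powerset with ¬ Even C.card, (-1 : ℤ) ^ C.card =
      -((A.powerset.filter fun C : Finset ι => ¬ Even C.card).card : ℤ) := by
    rw [Finset.sum_congr rfl fun C hC =>
      (Nat.not_even_iff_odd.1 (Finset.mem_filter.1 hC).2).neg_one_pow]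
    simp
  have h4 := Finset.card_filter_add_card_filter_not (s := A.powerset) fun C : Finset ι => Even C.card
  rw [Finset.card_powerset] at h4
  omega

/-- The subsets of a large set `A` can be labelled such that every label `v` with `0 < v < Q` is
used exactly `v` times, on sets of even size only. Hence the alternating sum over the subsets with
label `v` is `v`. -/
theorem exists_labelling {ι : Type*} [DecidableEq ι] {A : Finset ι} (hA : A.Nonempty) {Q : ℕ}
    (hQ : 0 < Q) (h : 2 * Q ^ 2 ≤ 2 ^ A.card) :
    ∃ c : Finset ι → ℕ, (∀ C, c C < Q) ∧ ∀ v, v ≠ 0 → v < Q →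
      ∑ C ∈ A.powerset, (-1 : ℤ) ^ C.card * (if c C = v then 1 else 0) = v := by
  classical
  have hcard : Fintype.card (Fin Q × Fin Q) ≤
      Fintype.card {C // C ∈ A.powerset.filter fun C : Finset ι => Even C.card} := by
    rw [Fintype.card_prod, Fintype.card_fin, Fintype.card_coe]
    have := two_mul_card_even_powerset hA
    rw [← this, pow_two] at h
    omega
  obtain ⟨e⟩ := Function.Embedding.nonempty_of_card_le hcard
  have hinj : ∀ p q, (e p : Finset ι) = e q → p = q := fun p q h => e.injective (Subtype.ext h)
  set c : Finset ι → ℕ := fun C =>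
    if h : ∃ p : Fin Q × Fin Q, p.2 < p.1 ∧ (e p : Finset ι) = C then h.choose.1 else 0 with hc
  have hc1 : ∀ C v, v ≠ 0 → ∀ hv : v < Q,
      (c C = v ↔ ∃ j : Fin Q, (j : ℕ) < v ∧ (e (⟨v, hv⟩, j) : Finset ι) = C) := by
    intro C v hv0 hv
    constructor
    · intro h
      simp only [hc] at h
      split_ifs at h with h'
      · obtain ⟨h1, h2⟩ := h'.choose_spec
        refine ⟨h'.choose.2, by rw [← h]; exact h1, ?_⟩
        rwa [show (⟨v, hv⟩, h'.choose.2) = h'.choose from Prod.ext (Fin.ext h.symm) rfl]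
      · exact absurd h.symm hv0
    · rintro ⟨j, hj, hC⟩
      have h' : ∃ p : Fin Q × Fin Q, p.2 < p.1 ∧ (e p : Finset ι) = C := ⟨(⟨v, hv⟩, j), hj, hC⟩
      simp only [hc, h', dif_pos]
      rw [hinj h'.choose (⟨v, hv⟩, j) (h'.choose_spec.2.trans hC.symm)]
  refine ⟨c, fun C => ?_, fun v hv0 hv => ?_⟩
  · simp only [hc]
    split_ifs
    · exact Fin.is_lt _
    · exact hQ
  · have hmem : ∀ p, (e p : Finset ι) ∈ A.powerset ∧ Even (e p : Finset ι).card := fun p =>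
      Finset.mem_filter.1 (e p).2
    have himg : A.powerset.filter (fun C => c C = v) =
        (Finset.univ.filter fun j : Fin Q => (j : ℕ) < v).image
          fun j => (e (⟨v, hv⟩, j) : Finset ι) := by
      ext C
      simp only [Finset.mem_filter, Finset.mem_image, Finset.mem_univ, true_and, hc1 C v hv0 hv]
      constructor
      · exact fun h => h.2
      · rintro ⟨j, hj, rfl⟩
        exact ⟨(hmem _).1, j, hj, rfl⟩
    simp only [mul_ite, mul_one, mul_zero]
    rw [← Finset.sum_filter, himg, Finset.sum_image fun i _ j _ h => (Prod.mk.inj (hinj _ _ h)).2,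
      Finset.sum_congr rfl fun j _ => (hmem _).2.neg_one_pow]
    simp only [Finset.sum_const, nsmul_eq_mul, mul_one]
    congr 1
    rw [show (Finset.univ.filter fun j : Fin Q => (j : ℕ) < v) = Finset.Iio ⟨v, hv⟩ by
      ext j; simp [Fin.lt_def]]
    simp

theorem sum_powerset_neg_one_pow_mul_inter {ι : Type*} [DecidableEq ι] {A A' : Finset ι} {a : ι}
    (ha : a ∈ A) (ha' : a ∉ A') (g : Finset ι → ℤ) :
    ∑ B ∈ A.powerset, (-1 : ℤ) ^ B.card * g (B ∩ A') = 0 := by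
  rw [← Finset.insert_erase ha, Finset.sum_powerset_insert (Finset.notMem_erase a A),
    ← Finset.sum_add_distrib]
  refine Finset.sum_eq_zero fun B hB => ?_
  have haB : a ∉ B := fun h => Finset.notMem_erase a A (Finset.mem_powerset.1 hB h)
  rw [Finset.card_insert_of_notMem haB, Finset.insert_inter_of_notMem ha', pow_succ]
  ring

/-- Lindström's detecting matrix, in a version where every unknown takes many values. The unknowns
`u A` and the queries `B` are both indexed by the subsets of a set with `k` elements; query `B`
compares each nonzero `u A` with the value `γ A B` and reports the number of agreements. As
`γ A B` depends on `B ∩ A` only, the alternating sum of the answers over `B ⊆ A` is not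
influenced by `u A'` unless `A ⊆ A'`, and so the unknowns can be determined from the largest sets
downwards. -/
theorem exists_detecting {k Q : ℕ} (hk : 0 < k) (hQ : 0 < Q)
    (h : ∀ s, k ≤ 2 * s → 2 * Q ^ 2 ≤ 2 ^ s) :
    ∃ γ : Finset (Fin k) → Finset (Fin k) → ℕ, (∀ A B, γ A B < Q) ∧
      ∀ u v : Finset (Fin k) → ℕ, (∀ A, u A < Q) → (∀ A, v A < Q) →
        (∀ A, u A ≠ 0 → k ≤ 2 * A.card) → (∀ A, v A ≠ 0 → k ≤ 2 * A.card) →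
        (∀ B, (Finset.univ.filter fun A => u A ≠ 0 ∧ γ A B = u A).card =
          (Finset.univ.filter fun A => v A ≠ 0 ∧ γ A B = v A).card) → u = v := by
  classical
  have hlab : ∀ A : Finset (Fin k), ∃ c : Finset (Fin k) → ℕ, (∀ C, c C < Q) ∧
      (k ≤ 2 * A.card → ∀ v, v ≠ 0 → v < Q →
        ∑ C ∈ A.powerset, (-1 : ℤ) ^ C.card * (if c C = v then 1 else 0) = v) := by
    intro A
    by_cases hA : k ≤ 2 * A.card
    · obtain ⟨c, h1, h2⟩ := exists_labelling (A := A) (Finset.card_pos.1 (by omega)) hQ (h _ hA)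
      exact ⟨c, h1, fun _ => h2⟩
    · exact ⟨fun _ => 0, fun _ => hQ, fun h' => absurd h' hA⟩
  choose c hc1 hc2 using hlab
  refine ⟨fun A B => c A (B ∩ A), fun A B => hc1 _ _, fun u v hu hv hu' hv' heq => ?_⟩
  by_contra hne
  have hS : (Finset.univ.filter fun A => u A ≠ v A).Nonempty := by
    obtain ⟨A, hA⟩ := Function.ne_iff.1 hne
    exact ⟨A, by simpa using hA⟩
  obtain ⟨A, hA, hmax⟩ := Finset.exists_max_image _ Finset.card hS
  simp only [Finset.mem_filter, Finset.mem_univ, true_and] at hA hmax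
  -- The contribution of the unknown with index `A'` to the alternating sum over `B ⊆ A`.
  set T : (Finset (Fin k) → ℕ) → Finset (Fin k) → ℤ := fun u A' =>
    ∑ B ∈ A.powerset, (-1 : ℤ) ^ B.card * (if u A' ≠ 0 ∧ c A' (B ∩ A') = u A' then 1 else 0)
    with hT
  have htot : ∑ A', T u A' = ∑ A', T v A' := by
    simp only [hT]
    rw [Finset.sum_comm, Finset.sum_comm (t := A.powerset)]
    refine Finset.sum_congr rfl fun B _ => ?_
    rw [← Finset.mul_sum, ← Finset.mul_sum, ← Finset.natCast_card_filter,
      ← Finset.natCast_card_filter, heq B]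
  have hself : ∀ u : Finset (Fin k) → ℕ, (∀ A, u A < Q) → (∀ A, u A ≠ 0 → k ≤ 2 * A.card) →
      T u A = u A := by
    intro u hu hu'
    by_cases h0 : u A = 0
    · simp [hT, h0]
    · simp only [hT]
      rw [← hc2 A (hu' A h0) (u A) h0 (hu A)]
      refine Finset.sum_congr rfl fun B hB => ?_
      rw [Finset.inter_eq_left.2 (Finset.mem_powerset.1 hB)]
      simp [h0]
  have hother : ∀ A', A' ≠ A → T u A' = T v A' := by
    intro A' hA'
    by_cases hsub : A ⊆ A'
    · have : u A' = v A' := by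
        by_contra hcon
        exact hA' (Finset.eq_of_subset_of_card_le hsub (hmax A' hcon)).symm
      simp only [hT, this]
    · obtain ⟨a, ha, ha'⟩ := Finset.not_subset.1 hsub
      simp only [hT]
      rw [sum_powerset_neg_one_pow_mul_inter ha ha'
          (fun C => if u A' ≠ 0 ∧ c A' C = u A' then 1 else 0),
        sum_powerset_neg_one_pow_mul_inter ha ha'
          (fun C => if v A' ≠ 0 ∧ c A' C = v A' then 1 else 0)]
  rw [← Finset.add_sum_erase _ _ (Finset.mem_univ A), ← Finset.add_sum_erase _ (T v)
    (Finset.mem_univ A), Finset.sum_congr rfl fun A' h => hother A' (Finset.ne_of_mem_erase h),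
    hself u hu hu', hself v hv hv'] at htot
  exact hA (by exact_mod_cast add_right_cancel htot)

theorem card_le_two_mul_card_large (k : ℕ) :
    2 ^ k ≤ 2 * Fintype.card {A : Finset (Fin k) // k ≤ 2 * A.card} := by
  classical
  have h1 : (Finset.univ.filter fun A : Finset (Fin k) => ¬ k ≤ 2 * A.card).card ≤
      (Finset.univ.filter fun A : Finset (Fin k) => k ≤ 2 * A.card).card := by
    refine Finset.card_le_card_of_injOn (fun A => Aᶜ) ?_ fun A _ B _ h => compl_injective h
    intro A hA
    simp only [Finset.coe_filter, Finset.mem_univ, true_and, Set.mem_ofPred_eq] at hA ⊢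
    rw [Finset.card_compl, Fintype.card_fin]
    omega
  have h2 := Finset.card_filter_add_card_filter_not
    (s := (Finset.univ : Finset (Finset (Fin k)))) fun A => k ≤ 2 * A.card
  rw [Finset.card_univ, Fintype.card_finset, Fintype.card_fin] at h2
  rw [Fintype.card_subtype]
  omega


/-! ### Rows of symbols decoded by a sliding pattern -/

/-- The number of agreements between a pattern `P` and a stream `u`, both infinite, when the first
symbol of the pattern is aligned with position `τ` and later symbols of the pattern with earlier
positions. Only the positions `s < M` are counted, and a position `s > τ` is compared with `0`. -/
def slidingMatches {q : ℕ} [NeZero q] (P u : ℕ → Fin q) (M τ : ℕ) : ℕ :=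
  ((Finset.range M).filter fun s => (if s ≤ τ then P (τ - s) else 0) = u s).card

/-- The stream obtained by concatenating the encodings, of length `L` each, of a sequence of
rows. -/
def concatRows {X σ : Type} (L : ℕ) (enc : X → ℕ → σ) (x : ℕ → X) (s : ℕ) : σ :=
  enc (x (s / L)) (s % L)

/-- A way to encode `2 ^ b` messages by rows of `L` symbols, together with a finite pattern, such
that sliding the pattern over a sequence of encoded messages and counting agreements reveals the
messages. The symbol `0` is used to extend the pattern, whose length is at most `L * H`. -/
structure SlidingCode (q : ℕ) [NeZero q] where
  /-- The number of symbols in a row. -/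
  L : ℕ
  /-- A bound on the length of the pattern, in rows. -/
  H : ℕ
  /-- The number of bits carried by a row. -/
  b : ℕ
  /-- The messages. -/
  X : Type
  [fintype : Fintype X]
  /-- The encoding of a message; only the first `L` symbols matter. -/
  enc : X → ℕ → Fin q
  /-- The pattern. -/
  P : ℕ → Fin q
  L_pos : 0 < L
  H_pos : 0 < H
  b_pos : 0 < b
  card_eq : Fintype.card X = 2 ^ b
  P_eq_zero : ∀ d, L * H ≤ d → P d = 0
  decode : ∀ (N : ℕ) (x y : ℕ → X),
    (∀ τ < L * (N + H), slidingMatches P (concatRows L enc x) (L * N) τ =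
      slidingMatches P (concatRows L enc y) (L * N) τ) → ∀ i < N, x i = y i

attribute [instance] SlidingCode.fintype

/-- For two or more symbols, single bits can be encoded by single symbols `0` and `1`, and a
pattern of length `1` compares one position with `1` and the other ones with `0`. -/
theorem exists_bit_slidingCode (q : ℕ) [NeZero q] (hq : 2 ≤ q) :
    ∃ C : SlidingCode q, C.L = 1 ∧ C.H = 1 ∧ C.b = 1 := by
  have h01 : Fin.ofNat q 1 ≠ 0 := by
    intro h
    have := congrArg Fin.val h
    simp [Nat.mod_eq_of_lt (show 1 < q by omega)] at this
  set one : Fin q := Fin.ofNat q 1 with hone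
  set P : ℕ → Fin q := fun d => if d = 0 then one else 0 with hP
  set enc : Bool → ℕ → Fin q := fun x _ => if x then one else 0 with henc
  -- The position `τ` is compared with `1` instead of `0`.
  have key : ∀ (N : ℕ) (x : ℕ → Bool),
      (slidingMatches P (concatRows 1 enc x) (1 * N) N : ℤ) =
        ∑ s ∈ Finset.range N, (if x s then 0 else 1) ∧
      ∀ τ < N, (slidingMatches P (concatRows 1 enc x) (1 * N) τ : ℤ) =
        ∑ s ∈ Finset.range N, (if x s then 0 else 1) + (if x τ then 1 else -1) := by
    intro N x
    have hterm : ∀ τ s, (if s ≤ τ then P (τ - s) else 0) = if s = τ then one else 0 := by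
      intro τ s
      simp only [hP]
      split_ifs <;> first | rfl | omega
    have hx : ∀ s, concatRows 1 enc x s = if x s then one else 0 := by
      intro s
      simp [concatRows, henc]
    constructor
    · unfold slidingMatches
      rw [Finset.natCast_card_filter, one_mul]
      refine Finset.sum_congr rfl fun s hs => ?_
      rw [hterm, hx, if_neg (Finset.mem_range.1 hs).ne]
      cases x s <;> simp [h01.symm]
    · intro τ hτ
      unfold slidingMatches
      rw [Finset.natCast_card_filter, one_mul,
        ← Finset.add_sum_erase _ _ (Finset.mem_range.2 hτ),
        ← Finset.add_sum_erase _ (fun s => if x s then (0 : ℤ) else 1) (Finset.mem_range.2 hτ)]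
      rw [Finset.sum_congr rfl (g := fun s => if x s then (0 : ℤ) else 1) fun s hs => ?_]
      · rw [hterm, hx]
        cases x τ <;> simp [h01, add_comm]
      · rw [hterm, hx, if_neg (Finset.ne_of_mem_erase hs)]
        cases x s <;> simp [h01.symm]
  refine ⟨{ L := 1, H := 1, b := 1, X := Bool, enc := enc, P := P, L_pos := one_pos,
            H_pos := one_pos, b_pos := one_pos, card_eq := by simp, P_eq_zero := ?_,
            decode := ?_ }, rfl, rfl, rfl⟩
  · intro d hd
    simp only [hP]
    rw [if_neg (by omega)]
  · intro N x y h i hi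
    have hN := h N (by omega)
    have hi' := h i (by omega)
    have hN' : (slidingMatches P (concatRows 1 enc x) (1 * N) N : ℤ) =
        slidingMatches P (concatRows 1 enc y) (1 * N) N := by exact_mod_cast hN
    have hi'' : (slidingMatches P (concatRows 1 enc x) (1 * N) i : ℤ) =
        slidingMatches P (concatRows 1 enc y) (1 * N) i := by exact_mod_cast hi'
    rw [(key N x).1, (key N y).1] at hN'
    rw [(key N x).2 i hi, (key N y).2 i hi, hN'] at hi''
    cases hxi : x i <;> cases hyi : y i <;> simp [hxi, hyi] at hi'' ⊢

/-- A detecting family with `R = 2 ^ (4 * κ + 2)` unknowns and as many queries is turned into a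
sliding code. A row holds one value for each unknown `b < R`, followed by `R` filler symbols; the
values of different unknowns are encoded by different symbols. The answers of the queries that
concern the unknown `r` form a block of length `R` at distance `(2 * R - 1) * r` in the pattern.
Position `2 * R * i + r` holds the unknown `r` of row `i`, so that at position `2 * R * j + B` with
`B < R` it is compared with entry `B` of this block if `i = j - r`, and with no entry of the block
otherwise. Hence the counts at these `R` positions are the answers of the queries about the
unknowns `r` of the rows `j - r`. -/
theorem exists_large_slidingCode (κ q : ℕ) [NeZero q] (hκ : 0 < κ) (hq : 2 ^ (5 * κ + 3) ≤ q) :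
    ∃ C : SlidingCode q, C.L = 2 ^ (4 * κ + 3) ∧ C.H = 2 ^ (4 * κ + 2) ∧
      2 ^ (4 * κ + 1) * κ ≤ C.b := by
  classical
  set k := 4 * κ + 2 with hk
  set R := 2 ^ k with hR
  set Q := 2 ^ κ with hQ
  have hRpos : 0 < R := by positivity
  have hQpos : 0 < Q := by positivity
  have hL : 2 ^ (4 * κ + 3) = 2 * R := by rw [hR, hk, ← pow_succ']
  have hq' : R * Q < q := by
    refine lt_of_lt_of_le ?_ hq
    rw [hR, hQ, ← pow_add]
    exact Nat.pow_lt_pow_right (by norm_num) (by omega)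
  obtain ⟨γ, hγ, hdet⟩ := exists_detecting (k := k) (Q := Q) (by omega) hQpos (by
    intro s hs
    rw [hQ, ← pow_mul, ← pow_succ']
    exact Nat.pow_le_pow_right (by norm_num) (by omega))
  have e : Fin R ≃ Finset (Fin k) := (Fintype.equivFinOfCardEq (by simp [hR])).symm
  -- The queries and unknowns, indexed by numbers instead of sets.
  set S : ℕ → Finset (Fin k) := fun r => if h : r < R then e ⟨r, h⟩ else ∅ with hS
  set sym : ℕ → ℕ → Fin q := fun r v => Fin.ofNat q (1 + r * Q + v) with hsym
  have hsymval : ∀ r < R, ∀ v < Q, (sym r v : ℕ) = 1 + r * Q + v := by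
    intro r hr v hv
    simp only [hsym, Fin.val_ofNat]
    refine Nat.mod_eq_of_lt ?_
    have : (r + 1) * Q ≤ R * Q := Nat.mul_le_mul_right _ hr
    rw [add_mul] at this
    omega
  have hsyminj : ∀ r < R, ∀ r' < R, ∀ v < Q, ∀ v' < Q, sym r v = sym r' v' → r = r' ∧ v = v' := by
    intro r hr r' hr' v hv v' hv' h
    have := congrArg Fin.val h
    rw [hsymval r hr v hv, hsymval r' hr' v' hv'] at this
    have h1 : r = r' := by
      have h2 : (Q * r + v) / Q = (Q * r' + v') / Q := by
        congr 1
        rw [mul_comm Q r, mul_comm Q r']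
        omega
      rwa [Nat.mul_add_div hQpos, Nat.mul_add_div hQpos, Nat.div_eq_of_lt hv,
        Nat.div_eq_of_lt hv'] at h2
    subst h1
    exact ⟨rfl, by omega⟩
  have hsym0 : ∀ r < R, ∀ v < Q, sym r v ≠ 0 := by
    intro r hr v hv h
    have := congrArg Fin.val h
    rw [hsymval r hr v hv] at this
    simp at this
  set X := ({A : Finset (Fin k) // k ≤ 2 * A.card} → Fin Q) with hX
  set val : X → Finset (Fin k) → ℕ := fun x A => if h : k ≤ 2 * A.card then x ⟨A, h⟩ else 0
    with hval
  have hvalQ : ∀ x A, val x A < Q := by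
    intro x A
    simp only [hval]
    split_ifs
    · exact Fin.is_lt _
    · exact hQpos
  set enc : X → ℕ → Fin q := fun x b => if b < R then sym b (val x (S b)) else sym 0 0 with henc
  set P : ℕ → Fin q := fun d => if d / (2 * R - 1) < R ∧ d % (2 * R - 1) < R ∧
      γ (S (d / (2 * R - 1))) (S (d % (2 * R - 1))) ≠ 0 then
    sym (d / (2 * R - 1)) (γ (S (d / (2 * R - 1))) (S (d % (2 * R - 1)))) else 0 with hP
  have hSe : ∀ A, ((e.symm A : Fin R) : ℕ) < R ∧ S (e.symm A : Fin R) = A := by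
    intro A
    refine ⟨Fin.is_lt _, ?_⟩
    simp [hS]
  have heS : ∀ r < R, ((e.symm (S r) : Fin R) : ℕ) = r := by
    intro r hr
    simp [hS, hr]
  -- The values of the unknowns seen from row `j`; unknowns outside the given rows are absent.
  set seen : ℕ → (ℕ → X) → ℕ → Finset (Fin k) → ℕ := fun N x j A =>
    if (e.symm A : ℕ) ≤ j ∧ j - (e.symm A : ℕ) < N then val (x (j - (e.symm A : ℕ))) A else 0
    with hseen
  have hPsym : ∀ d b v, b < R → v < Q → (P d = sym b v ↔
      d / (2 * R - 1) = b ∧ d % (2 * R - 1) < R ∧ v ≠ 0 ∧ γ (S b) (S (d % (2 * R - 1))) = v) := by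
    intro d b v hb hv
    simp only [hP]
    constructor
    · intro h
      split_ifs at h with h'
      · obtain ⟨h1, h2⟩ := hsyminj _ h'.1 _ hb _ (hγ _ _) _ hv h
        exact ⟨h1, h'.2.1, by rw [← h2]; exact h'.2.2, by rw [← h1]; exact h2⟩
      · exact absurd h.symm (hsym0 b hb v hv)
    · rintro ⟨h1, h2, h3, h4⟩
      rw [h1, h4, if_pos ⟨hb, h2, h3⟩]
  have hsum : ∀ N x j B, B < R →
      slidingMatches P (concatRows (2 * R) enc x) (2 * R * N) (2 * R * j + B) =
        (Finset.univ.filter fun A => seen N x j A ≠ 0 ∧ γ A (S B) = seen N x j A).card := by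
    intro N x j B hB
    -- Agreements occur only at the positions `2 * R * (j - b) + b` with `b < R`.
    have hiff : ∀ i b, b < 2 * R →
        ((if 2 * R * i + b ≤ 2 * R * j + B then P (2 * R * j + B - (2 * R * i + b)) else 0) =
            enc (x i) b ↔
          b < R ∧ i + b = j ∧ val (x i) (S b) ≠ 0 ∧ γ (S b) (S B) = val (x i) (S b)) := by
      intro i b hb
      simp only [henc]
      by_cases hbR : b < R
      · rw [if_pos hbR]
        have hv := hvalQ (x i) (S b)
        split_ifs with hle
        · rw [hPsym _ _ _ hbR hv]
          obtain ⟨d, hd⟩ := Nat.exists_eq_add_of_le hle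
          have hd' : 2 * R * j + B - (2 * R * i + b) = d := by omega
          rw [hd']
          constructor
          · rintro ⟨h1, h2, h3, h4⟩
            have h5 := Nat.div_add_mod d (2 * R - 1)
            rw [h1] at h5
            have h6 : (2 * R - 1) * b + b = 2 * R * b := by
              rw [Nat.sub_mul, one_mul]
              have : b ≤ 2 * R * b := Nat.le_mul_of_pos_left b (by omega)
              omega
            have h7 : 2 * R * j + B = 2 * R * (i + b) + d % (2 * R - 1) := by
              rw [mul_add]
              omega
            have h8 : j = i + b := by
              have := congrArg (· / (2 * R)) h7
              rwa [Nat.mul_add_div (by omega), Nat.mul_add_div (by omega),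
                Nat.div_eq_of_lt (by omega), Nat.div_eq_of_lt (show _ < 2 * R by omega)] at this
            subst h8
            have h9 : d % (2 * R - 1) = B := by omega
            rw [h9] at h4
            exact ⟨hbR, rfl, h3, h4⟩
          · rintro ⟨-, rfl, h3, h4⟩
            have h6 : (2 * R - 1) * b + b = 2 * R * b := by
              rw [Nat.sub_mul, one_mul]
              have : b ≤ 2 * R * b := Nat.le_mul_of_pos_left b (by omega)
              omega
            have h7 : d = (2 * R - 1) * b + B := by
              rw [mul_add] at hd
              omega
            have h8 : d / (2 * R - 1) = b := by
              rw [h7, Nat.mul_add_div (by omega), Nat.div_eq_of_lt (by omega), add_zero]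
            have h9 : d % (2 * R - 1) = B := by
              have := Nat.div_add_mod d (2 * R - 1)
              rw [h8] at this
              omega
            rw [h9]
            exact ⟨h8, hB, h3, h4⟩
        · constructor
          · intro h
            exact absurd h.symm (hsym0 b hbR _ hv)
          · rintro ⟨-, rfl, -, -⟩
            rw [mul_add] at hle
            have : b ≤ 2 * R * b := Nat.le_mul_of_pos_left b (by omega)
            rcases Nat.eq_zero_or_pos b with hb0 | hb0
            · subst hb0
              omega
            · have : 2 * R ≤ 2 * R * b := Nat.le_mul_of_pos_right _ hb0
              omega
      · rw [if_neg hbR]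
        constructor
        · intro h
          split_ifs at h with hle
          · exact absurd rfl ((hPsym _ 0 0 hRpos hQpos).1 h).2.2.1
          · exact absurd h.symm (hsym0 0 hRpos 0 hQpos)
        · exact fun h => absurd h.1 hbR
    have hiff' : ∀ s, ((if s ≤ 2 * R * j + B then P (2 * R * j + B - s) else 0) =
        concatRows (2 * R) enc x s ↔
          s % (2 * R) < R ∧ s / (2 * R) + s % (2 * R) = j ∧
          val (x (s / (2 * R))) (S (s % (2 * R))) ≠ 0 ∧
          γ (S (s % (2 * R))) (S B) = val (x (s / (2 * R))) (S (s % (2 * R)))) := by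
      intro s
      have := hiff (s / (2 * R)) (s % (2 * R)) (Nat.mod_lt _ (by omega))
      rw [Nat.div_add_mod] at this
      exact this
    unfold slidingMatches
    refine Finset.card_nbij' (fun s => S (s % (2 * R)))
      (fun A => 2 * R * (j - (e.symm A : ℕ)) + (e.symm A : ℕ)) ?_ ?_ ?_ ?_
    · intro s hs
      simp only [Finset.coe_filter, Finset.mem_range, Set.mem_ofPred_eq, hiff'] at hs
      obtain ⟨hsN, hsR, hj, h0, hg⟩ := hs
      have hdiv : s / (2 * R) < N := (Nat.div_lt_iff_lt_mul (by omega)).2 (by rwa [mul_comm])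
      have hjs : j - s % (2 * R) = s / (2 * R) := by rw [← hj, Nat.add_sub_cancel]
      have : seen N x j (S (s % (2 * R))) = val (x (s / (2 * R))) (S (s % (2 * R))) := by
        simp only [hseen, heS _ hsR]
        rw [hjs, if_pos ⟨hj ▸ Nat.le_add_left _ _, hdiv⟩]
      simp only [Finset.coe_filter, Finset.mem_univ, true_and, Set.mem_ofPred_eq, this]
      exact ⟨h0, hg⟩
    · intro A hA
      simp only [Finset.coe_filter, Finset.mem_univ, true_and, Set.mem_ofPred_eq] at hA
      obtain ⟨h0, hg⟩ := hA
      have hcond : (e.symm A : ℕ) ≤ j ∧ j - (e.symm A : ℕ) < N := by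
        by_contra hcon
        simp only [hseen, if_neg hcon] at h0
        exact h0 rfl
      have hlt := (hSe A).1
      have hmod : (2 * R * (j - (e.symm A : ℕ)) + (e.symm A : ℕ)) % (2 * R) = (e.symm A : ℕ) := by
        rw [Nat.mul_add_mod, Nat.mod_eq_of_lt (by omega)]
      have hdiv : (2 * R * (j - (e.symm A : ℕ)) + (e.symm A : ℕ)) / (2 * R) =
          j - (e.symm A : ℕ) := by
        rw [Nat.mul_add_div (by omega), Nat.div_eq_of_lt (by omega), add_zero]
      simp only [Finset.coe_filter, Finset.mem_range, Set.mem_ofPred_eq, hiff', hmod, hdiv,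
        (hSe A).2]
      simp only [hseen, if_pos hcond] at h0 hg
      refine ⟨?_, hlt, by omega, h0, hg⟩
      calc 2 * R * (j - (e.symm A : ℕ)) + (e.symm A : ℕ)
          < 2 * R * (j - (e.symm A : ℕ) + 1) := by rw [mul_add]; omega
        _ ≤ 2 * R * N := Nat.mul_le_mul_left _ (by omega)
    · intro s hs
      simp only [Finset.coe_filter, Finset.mem_range, Set.mem_ofPred_eq, hiff'] at hs
      obtain ⟨hsN, hsR, hj, h0, hg⟩ := hs
      simp only [heS _ hsR]
      rw [← hj, Nat.add_sub_cancel, Nat.div_add_mod]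
    · intro A hA
      have hlt := (hSe A).1
      simp only
      rw [Nat.mul_add_mod, Nat.mod_eq_of_lt (by omega), (hSe A).2]
  refine ⟨{ L := 2 * R, H := R, b := Fintype.card {A : Finset (Fin k) // k ≤ 2 * A.card} * κ,
            X := X, enc := enc, P := P, L_pos := by omega, H_pos := hRpos, b_pos := ?_,
            card_eq := ?_, P_eq_zero := ?_, decode := ?_ }, hL.symm, rfl, ?_⟩
  · have h1 := card_le_two_mul_card_large k
    exact Nat.mul_pos (by omega) hκ
  · simp only [hX, Fintype.card_fun, Fintype.card_fin, hQ]
    rw [← pow_mul, mul_comm]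
  · intro d hd
    simp only [hP]
    rw [if_neg]
    rintro ⟨h, -, -⟩
    rw [Nat.div_lt_iff_lt_mul (by omega)] at h
    have : R * (2 * R - 1) ≤ R * (2 * R) := Nat.mul_le_mul_left _ (by omega)
    rw [mul_comm (2 * R)] at hd
    omega
  · intro N x y h i hi
    have hu : ∀ j < N + R, seen N x j = seen N y j := by
      intro j hj
      have hlt : ∀ (x : ℕ → X) A, seen N x j A < Q := by
        intro x A
        simp only [hseen]
        split_ifs
        · exact hvalQ _ _
        · exact hQpos
      have hbig : ∀ (x : ℕ → X) A, seen N x j A ≠ 0 → k ≤ 2 * A.card := by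
        intro x A hA
        by_contra hcon
        refine hA ?_
        simp only [hseen, hval, dif_neg hcon, ite_self]
      refine hdet _ _ (hlt x) (hlt y) (hbig x) (hbig y) fun B => ?_
      have hB := hSe B
      have hτ : 2 * R * j + (e.symm B : ℕ) < 2 * R * (N + R) := by
        calc 2 * R * j + (e.symm B : ℕ) < 2 * R * (j + 1) := by rw [mul_add]; omega
          _ ≤ 2 * R * (N + R) := Nat.mul_le_mul_left _ hj
      have := h _ hτ
      rw [hsum N x j _ hB.1, hsum N y j _ hB.1, hB.2] at this
      exact this
    funext ⟨A, hA⟩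
    have hlt := (hSe A).1
    have := congrFun (hu (i + (e.symm A : ℕ)) (by omega)) A
    simp only [hseen] at this
    rw [if_pos ⟨by omega, by omega⟩, if_pos ⟨by omega, by omega⟩, Nat.add_sub_cancel] at this
    simp only [hval, dif_pos hA] at this
    exact Fin.ext this
  · refine Nat.mul_le_mul_right _ ?_
    have h1 := card_le_two_mul_card_large k
    have h2 : 2 ^ k = 2 * 2 ^ (4 * κ + 1) := by rw [hk, ← pow_succ']
    omega

/-- For an alphabet with `2 ^ δ` symbols there is a sliding code of constant rate whose pattern
is short. -/
theorem exists_slidingCode (δ : ℕ) (hδ : 1 ≤ δ) : ∃ C : SlidingCode (2 ^ δ),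
    C.L * δ ≤ 128 * C.b ∧ (C.L * C.H) ^ 2 ≤ 2 ^ (δ + 10) := by
  by_cases h : δ < 16
  · obtain ⟨C, h1, h2, h3⟩ := exists_bit_slidingCode (2 ^ δ)
      (by simpa using Nat.pow_le_pow_right (n := 2) (by norm_num) hδ)
    refine ⟨C, by rw [h1, h3]; omega, ?_⟩
    rw [h1, h2]
    exact Nat.one_le_two_pow
  · obtain ⟨C, h1, h2, h3⟩ := exists_large_slidingCode (δ / 16) (2 ^ δ) (by omega)
      (Nat.pow_le_pow_right (by norm_num) (by omega))
    refine ⟨C, ?_, ?_⟩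
    · have h4 : δ ≤ 32 * (δ / 16) := by omega
      rw [h1]
      calc 2 ^ (4 * (δ / 16) + 3) * δ ≤ 2 ^ (4 * (δ / 16) + 3) * (32 * (δ / 16)) :=
            Nat.mul_le_mul_left _ h4
        _ = 128 * (2 ^ (4 * (δ / 16) + 1) * (δ / 16)) := by ring
        _ ≤ 128 * C.b := Nat.mul_le_mul_left _ h3
    · rw [h1, h2, ← pow_add, ← pow_mul]
      exact Nat.pow_le_pow_right (by norm_num) (by omega)


/-! ### A fixed string that works at all scales -/

theorem window_of_lt {n m : ℕ} {σ : Type} (S₀ : Fin n → σ) (U : Fin m → σ) (t : Fin m) (i : Fin n)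
    (h : t + 1 + (i : ℕ) < n) : window S₀ U t i = S₀ ⟨t + 1 + i, h⟩ := by
  simp [window, Fin.append, Fin.addCases, h]

theorem window_of_le {n m : ℕ} {σ : Type} (S₀ : Fin n → σ) (U : Fin m → σ) (t : Fin m) (i : Fin n)
    (h : n ≤ t + 1 + (i : ℕ)) : window S₀ U t i = U ⟨t + 1 + i - n, by omega⟩ := by
  simp [window, Fin.append, Fin.addCases, not_lt.2 h]

/-- For a string whose symbols are given as a function `f` of the age of the symbol compared with,
the Hamming distance is, up to a term that does not depend on the arriving symbols, minus the
number of agreements with the symbols that have arrived. -/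
theorem exists_hammingDist_add_eq {n : ℕ} {σ : Type} [DecidableEq σ] (f : ℕ → σ) (S₀ : Fin n → σ)
    (t : Fin n) : ∃ c : ℕ, ∀ u : ℕ → σ,
      hammingDist (fun i : Fin n => f (n - 1 - i)) (window S₀ (fun i : Fin n => u i) t) +
        ((Finset.range (t + 1)).filter fun s => f (t - s) = u s).card = c := by
  refine ⟨n - (Finset.univ.filter fun i : Fin n =>
    ∃ h : t + 1 + (i : ℕ) < n, f (n - 1 - i) = S₀ ⟨t + 1 + i, h⟩).card, fun u => ?_⟩
  set w := window S₀ (fun i : Fin n => u i) t with hw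
  have h1 := Finset.card_filter_add_card_filter_not
    (s := (Finset.univ : Finset (Fin n))) fun i => f (n - 1 - i) = w i
  have h2 := Finset.card_filter_add_card_filter_not
    (s := Finset.univ.filter fun i : Fin n => f (n - 1 - i) = w i)
      fun i => t + 1 + (i : ℕ) < n
  rw [Finset.filter_filter, Finset.filter_filter] at h2
  have h3 : (Finset.univ.filter fun i : Fin n => f (n - 1 - i) = w i ∧ t + 1 + (i : ℕ) < n) =
      Finset.univ.filter fun i : Fin n =>
        ∃ h : t + 1 + (i : ℕ) < n, f (n - 1 - i) = S₀ ⟨t + 1 + i, h⟩ := by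
    refine Finset.filter_congr fun i _ => ?_
    constructor
    · rintro ⟨h, h'⟩
      exact ⟨h', by rw [h, hw, window_of_lt _ _ _ _ h']⟩
    · rintro ⟨h', h⟩
      exact ⟨by rw [h, hw, window_of_lt _ _ _ _ h'], h'⟩
  have h4 : (Finset.univ.filter fun i : Fin n =>
      f (n - 1 - i) = w i ∧ ¬ t + 1 + (i : ℕ) < n).card =
        ((Finset.range (t + 1)).filter fun s => f (t - s) = u s).card := by
    refine Finset.card_bij (fun i _ => t + 1 + (i : ℕ) - n) ?_ ?_ ?_
    · intro i hi
      simp only [Finset.mem_filter, Finset.mem_univ, true_and] at hi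
      obtain ⟨h, h'⟩ := hi
      rw [hw, window_of_le _ _ _ _ (by omega)] at h
      rw [Finset.mem_filter, Finset.mem_range, ← h]
      exact ⟨by omega, congrArg f (by omega)⟩
    · intro i hi j hj hij
      simp only [Finset.mem_filter, Finset.mem_univ, true_and] at hi hj
      exact Fin.ext (by omega)
    · intro s hs
      rw [Finset.mem_filter, Finset.mem_range] at hs
      have hlt : n - 1 - t + s < n := by omega
      refine ⟨⟨n - 1 - t + s, hlt⟩, ?_, by simp only; omega⟩
      simp only [Finset.mem_filter, Finset.mem_univ, true_and]
      refine ⟨?_, by omega⟩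
      rw [hw, window_of_le _ _ _ _ (by simp only; omega)]
      simp only
      rw [show n - 1 - (n - 1 - t + s) = t - s by omega, hs.2]
      congr 1
      omega
  have h5 : hammingDist (fun i : Fin n => f (n - 1 - i)) w =
      (Finset.univ.filter fun i : Fin n => ¬ f (n - 1 - i) = w i).card := rfl
  rw [Finset.card_univ, Fintype.card_fin] at h1
  rw [h3] at h2
  omega

namespace SlidingCode

variable {q : ℕ} [NeZero q] (C : SlidingCode q)

/-- The symbol of the fixed string that is compared with a symbol of age `d`. For every `k`, a
copy of the pattern begins at age `C.L * 2 ^ k`; all other symbols are `0`. -/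
def ageSymbol (d : ℕ) : Fin q := C.P (d - C.L * 2 ^ Nat.log 2 (d / C.L))

/-- The fixed string of length `n`. -/
def fixedString (n : ℕ) : Fin n → Fin q := fun i => C.ageSymbol (n - 1 - i)

/-- The update sequence that consists of the encodings of `n / C.L` rows, with the remaining
symbols set to `0`. -/
def updates (n : ℕ) (ω : Fin (n / C.L) → C.X) (t : ℕ) : Fin q :=
  if h : t / C.L < n / C.L then C.enc (ω ⟨t / C.L, h⟩) (t % C.L) else 0

instance : Nonempty C.X := by
  rw [← Fintype.card_pos_iff, C.card_eq]
  positivity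

/-- Ages around `C.L * 2 ^ (ν + 2)` meet only the copy of the pattern that begins at this age. -/
theorem ageSymbol_eq {ν : ℕ} (hH : C.H ≤ 2 ^ ν) {τ s : ℕ} (hτ : τ < C.L * (4 * 2 ^ ν))
    (hs : s < C.L * 2 ^ ν) :
    C.ageSymbol (C.L * (4 * 2 ^ ν) + τ - s) = if s ≤ τ then C.P (τ - s) else 0 := by
  have hL := C.L_pos
  have hLH : C.L * C.H ≤ C.L * 2 ^ ν := Nat.mul_le_mul_left _ hH
  have h8 : 2 ^ (ν + 2 + 1) * C.L = 8 * (C.L * 2 ^ ν) := by ring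
  have h4 : 2 ^ (ν + 2) * C.L = 4 * (C.L * 2 ^ ν) := by ring
  have h2 : 2 ^ (ν + 1) * C.L = 2 * (C.L * 2 ^ ν) := by ring
  rw [show C.L * (4 * 2 ^ ν) = 4 * (C.L * 2 ^ ν) by ring] at hτ ⊢
  unfold ageSymbol
  split_ifs with h
  · have hlog : Nat.log 2 ((4 * (C.L * 2 ^ ν) + τ - s) / C.L) = ν + 2 := by
      rw [Nat.log_eq_iff (Or.inl (by omega))]
      rw [Nat.le_div_iff_mul_le hL, Nat.div_lt_iff_lt_mul hL, h8, h4]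
      omega
    rw [hlog, mul_comm C.L (2 ^ (ν + 2)), h4]
    congr 1
    omega
  · have hlog : Nat.log 2 ((4 * (C.L * 2 ^ ν) + τ - s) / C.L) = ν + 1 := by
      rw [Nat.log_eq_iff (Or.inl (by omega))]
      rw [Nat.le_div_iff_mul_le hL, Nat.div_lt_iff_lt_mul hL, h4, h2]
      omega
    rw [hlog, mul_comm C.L (2 ^ (ν + 1)), h2]
    exact C.P_eq_zero _ (by omega)

/-- The outputs in the right half of a group of `8 * 2 ^ ν` rows determine the first
`2 ^ ν` rows of the group when all other rows are known. -/
theorem rows_eq_of_hammingDist_eq {n ν g : ℕ} (hH : C.H ≤ 2 ^ ν)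
    (hg : 8 * 2 ^ ν * (g + 1) ≤ n / C.L) (S₀ : Fin n → Fin q) (ω ω' : Fin (n / C.L) → C.X)
    (hω : ∀ i : Fin (n / C.L), ¬ (8 * 2 ^ ν * g ≤ i ∧ (i : ℕ) < 8 * 2 ^ ν * g + 2 ^ ν) →
      ω i = ω' i)
    (hd : ∀ t : Fin n, C.L * (8 * 2 ^ ν * g + 4 * 2 ^ ν) ≤ t →
      (t : ℕ) < C.L * (8 * 2 ^ ν * (g + 1)) →
      hammingDist (C.fixedString n) (window S₀ (fun i => C.updates n ω i) t) =
        hammingDist (C.fixedString n) (window S₀ (fun i => C.updates n ω' i) t)) :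
    ω = ω' := by
  have hL := C.L_pos
  set N := 2 ^ ν with hN
  have hNpos : 0 < N := by positivity
  set B := 8 * N * g with hB
  have hg' : B + 8 * N ≤ n / C.L := by
    rw [mul_add, mul_one] at hg
    exact hg
  have hage : ∀ {τ s : ℕ}, τ < C.L * (4 * N) → s < C.L * N →
      C.ageSymbol (C.L * (4 * N) + τ - s) = if s ≤ τ then C.P (τ - s) else 0 := C.ageSymbol_eq hH
  have hgn : C.L * (B + 8 * N) ≤ n :=
    (Nat.mul_le_mul_left _ hg').trans (Nat.mul_div_le n C.L)
  -- The rows as infinite sequences, so that `decode` applies.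
  set ext : (Fin (n / C.L) → C.X) → ℕ → C.X := fun ω i =>
    if h : B + i < n / C.L then ω ⟨B + i, h⟩ else Classical.arbitrary _ with hext
  have hupd : ∀ (ω : Fin (n / C.L) → C.X) s, s < C.L * N →
      C.updates n ω (C.L * B + s) = concatRows C.L C.enc (ext ω) s := by
    intro ω s hs
    have h1 : (C.L * B + s) / C.L = B + s / C.L := Nat.mul_add_div hL _ _
    have h2 : s / C.L < N := (Nat.div_lt_iff_lt_mul hL).2 (by rwa [mul_comm])
    have h3 : B + s / C.L < n / C.L := by omega
    simp only [updates, concatRows, hext, h1, h3, dif_pos, Nat.mul_add_mod]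
  have hout : ∀ s, ¬ (C.L * B ≤ s ∧ s < C.L * B + C.L * N) →
      C.updates n ω s = C.updates n ω' s := by
    intro s hs
    simp only [updates]
    split_ifs with h
    · rw [hω]
      rintro ⟨h1, h2⟩
      refine hs ⟨?_, ?_⟩
      · rw [mul_comm]
        exact (Nat.le_div_iff_mul_le hL).1 h1
      · rw [← mul_add, mul_comm]
        exact (Nat.div_lt_iff_lt_mul hL).1 h2
    · rfl
  have hslide : ∀ (ω : Fin (n / C.L) → C.X) τ, τ < C.L * (4 * N) →
      ((Finset.range (C.L * (B + 4 * N) + τ + 1)).filter fun s =>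
        C.ageSymbol (C.L * (B + 4 * N) + τ - s) = C.updates n ω s ∧
          (C.L * B ≤ s ∧ s < C.L * B + C.L * N)).card =
      slidingMatches C.P (concatRows C.L C.enc (ext ω)) (C.L * N) τ := by
    intro ω τ hτ
    unfold slidingMatches
    symm
    have h4 : C.L * (B + 4 * N) = C.L * B + C.L * (4 * N) := mul_add _ _ _
    have h5 : C.L * (4 * N) = 4 * (C.L * N) := by ring
    refine Finset.card_bij (fun s _ => C.L * B + s) ?_ (fun _ _ _ _ h => by simpa using h) ?_
    · intro s hs
      rw [Finset.mem_filter, Finset.mem_range] at hs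
      rw [Finset.mem_filter, Finset.mem_range, hupd ω s hs.1, ← hs.2,
        ← hage hτ hs.1]
      exact ⟨by omega, congrArg _ (by omega), by omega, by omega⟩
    · intro s hs
      rw [Finset.mem_filter, Finset.mem_range] at hs
      obtain ⟨h1, h2, h3, h6⟩ := hs
      obtain ⟨s, rfl⟩ := Nat.exists_eq_add_of_le h3
      have hs : s < C.L * N := by omega
      refine ⟨s, ?_, rfl⟩
      rw [Finset.mem_filter, Finset.mem_range, ← hupd ω s hs, ← h2, ← hage hτ hs]
      exact ⟨hs, congrArg _ (by omega)⟩
  have hdec := C.decode N (ext ω) (ext ω') (by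
    intro τ hτ
    have hτ' : τ < C.L * (4 * N) := hτ.trans_le (Nat.mul_le_mul_left _ (by omega))
    rw [← hslide ω τ hτ', ← hslide ω' τ hτ']
    have hlt : C.L * (B + 4 * N) + τ < C.L * (B + 8 * N) := by
      have : C.L * (B + 8 * N) = C.L * (B + 4 * N) + C.L * (4 * N) := by ring
      omega
    obtain ⟨c, hc⟩ := exists_hammingDist_add_eq C.ageSymbol S₀
      ⟨C.L * (B + 4 * N) + τ, hlt.trans_le hgn⟩
    have h1 := hc (C.updates n ω)
    have h2 := hc (C.updates n ω')
    have h3 := hd ⟨C.L * (B + 4 * N) + τ, hlt.trans_le hgn⟩ (by simp)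
      (by rw [show 8 * N * (g + 1) = B + 8 * N by rw [hB]; ring]; exact hlt)
    unfold fixedString at h3
    rw [h3] at h1
    have h6 := h1.trans h2.symm
    simp only [add_right_inj] at h6
    have h7 : ∀ ω : Fin (n / C.L) → C.X, _ := fun ω => Finset.card_filter_add_card_filter_not
      (s := (Finset.range (C.L * (B + 4 * N) + τ + 1)).filter fun s =>
        C.ageSymbol (C.L * (B + 4 * N) + τ - s) = C.updates n ω s)
      fun s => C.L * B ≤ s ∧ s < C.L * B + C.L * N
    have h8 := h7 ω
    have h9 := h7 ω'
    rw [Finset.filter_filter, Finset.filter_filter] at h8 h9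
    have h10 : ((Finset.range (C.L * (B + 4 * N) + τ + 1)).filter fun s =>
        C.ageSymbol (C.L * (B + 4 * N) + τ - s) = C.updates n ω s ∧
          ¬ (C.L * B ≤ s ∧ s < C.L * B + C.L * N)) =
        (Finset.range (C.L * (B + 4 * N) + τ + 1)).filter fun s =>
        C.ageSymbol (C.L * (B + 4 * N) + τ - s) = C.updates n ω' s ∧
          ¬ (C.L * B ≤ s ∧ s < C.L * B + C.L * N) := by
      refine Finset.filter_congr fun s _ => ?_
      by_cases hs : C.L * B ≤ s ∧ s < C.L * B + C.L * N
      · simp [hs]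
      · rw [hout s hs]
    rw [h10] at h8
    omega)
  funext i
  by_cases hi : B ≤ i ∧ (i : ℕ) < B + N
  · have := hdec (i - B) (by omega)
    have h1 : B + ((i : ℕ) - B) = i := by omega
    simp only [hext, h1, i.is_lt, dif_pos] at this
    exact this
  · exact hω i hi

/-! ### The expected number of probes -/

/-- The average amount of information transfer between the two halves of a group of `8 * 2 ^ ν`
rows. -/
theorem le_sum_card_transfer {n ν g w : ℕ} (hH : C.H ≤ 2 ^ ν) (hν : 3 ≤ ν)
    (hg : 8 * 2 ^ ν * (g + 1) ≤ n / C.L) (S₀ : Fin n → Fin q) (A : Algorithm w (Fin q) n)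
    (hA : A.SolvesHamming (C.fixedString n) S₀) :
    (Fintype.card (Fin (n / C.L) → C.X) : ℝ) * (C.b * 2 ^ ν) ≤
      4 * w * ∑ ω : Fin (n / C.L) → C.X,
        ((A.transfer (fun i => C.updates n ω i) (C.L * (8 * 2 ^ ν * g))
          (C.L * (8 * 2 ^ ν * g + 4 * 2 ^ ν)) (C.L * (8 * 2 ^ ν * (g + 1)))).card : ℝ) := by
  classical
  have hL := C.L_pos
  set p : Fin (n / C.L) → Prop := fun i =>
    8 * 2 ^ ν * g ≤ i ∧ (i : ℕ) < 8 * 2 ^ ν * g + 2 ^ ν with hp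
  set T : (Fin (n / C.L) → C.X) → ℝ := fun ω =>
    ((A.transfer (fun i => C.updates n ω i) (C.L * (8 * 2 ^ ν * g))
      (C.L * (8 * 2 ^ ν * g + 4 * 2 ^ ν)) (C.L * (8 * 2 ^ ν * (g + 1)))).card : ℝ) with hT
  set E := Equiv.piEquivPiSubtypeProd p (fun _ => C.X) with hE
  have hEp : ∀ (θ : {i // p i} → C.X) (η : {i // ¬ p i} → C.X) i (hi : ¬ p i),
      E.symm (θ, η) i = η ⟨i, hi⟩ := by
    intro θ η i hi
    simp [hE, Equiv.piEquivPiSubtypeProd, hi]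
  have hcard : Fintype.card {i // p i} = 2 ^ ν := by
    rw [Fintype.card_subtype]
    calc (Finset.univ.filter p).card
        = (Finset.Ico (8 * 2 ^ ν * g) (8 * 2 ^ ν * g + 2 ^ ν)).card := by
          refine Finset.card_bij (fun i _ => (i : ℕ)) ?_ (fun _ _ _ _ h => Fin.ext h) ?_
          · intro i hi
            exact Finset.mem_Ico.2 (Finset.mem_filter.1 hi).2
          · intro i hi
            have h1 := Finset.mem_Ico.1 hi
            have h2 : i < n / C.L := by
              rw [mul_add, mul_one] at hg
              omega
            exact ⟨⟨i, h2⟩, Finset.mem_filter.2 ⟨Finset.mem_univ _, h1⟩, rfl⟩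
      _ = 2 ^ ν := by simp
  have hcardΘ : (Fintype.card ({i // p i} → C.X) : ℝ) = 2 ^ (C.b * 2 ^ ν) := by
    rw [Fintype.card_fun, hcard, C.card_eq, ← pow_mul]
    push_cast
    rfl
  have hone : ∀ η : {i // ¬ p i} → C.X,
      (Fintype.card ({i // p i} → C.X) : ℝ) * (C.b * 2 ^ ν) ≤
        4 * w * ∑ θ : {i // p i} → C.X, T (E.symm (θ, η)) := by
    intro η
    have h1 := A.le_sum_card_transfer (Θ := {i // p i} → C.X)
      (fun θ i => C.updates n (E.symm (θ, η)) i) (C.L * (8 * 2 ^ ν * g))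
      (C.L * (8 * 2 ^ ν * g + 4 * 2 ^ ν)) (C.L * (8 * 2 ^ ν * (g + 1))) (by
        intro θ θ' i hi
        simp only [updates]
        split_ifs with h
        · have hnp : ¬ p ⟨(i : ℕ) / C.L, h⟩ := by
            rintro ⟨h1, h2⟩
            simp only at h1 h2
            rw [Nat.le_div_iff_mul_le hL, mul_comm] at h1
            rw [Nat.div_lt_iff_lt_mul hL, mul_comm] at h2
            have : C.L * (8 * 2 ^ ν * g + 2 ^ ν) ≤ C.L * (8 * 2 ^ ν * g + 4 * 2 ^ ν) :=
              Nat.mul_le_mul_left _ (by omega)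
            omega
          rw [hEp _ _ _ hnp, hEp _ _ _ hnp]
        · rfl)
      (by
        intro θ θ' h
        have := C.rows_eq_of_hammingDist_eq hH hg S₀ (E.symm (θ, η)) (E.symm (θ', η))
          (fun i hi => by rw [hEp _ _ _ hi, hEp _ _ _ hi])
          (fun t h1 h2 => by rw [← hA, ← hA]; exact h t h1 h2)
        exact (Prod.mk.inj (E.symm.injective this)).1)
    rw [hcardΘ, Real.log_pow] at h1
    rw [hcardΘ]
    have hb : (8 : ℝ) ≤ C.b * 2 ^ ν := by
      have h2 : (1 : ℝ) ≤ C.b := by exact_mod_cast C.b_pos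
      have h3 : (2 : ℝ) ^ 3 ≤ 2 ^ ν := pow_le_pow_right₀ (by norm_num) hν
      nlinarith
    have hlog := Real.log_two_gt_d9
    have h4 : (2 : ℝ) ^ (C.b * 2 ^ ν) * ((C.b * 2 ^ ν) * Real.log 2 / 2) ≤
        2 * w * Real.log 2 * ∑ θ : {i // p i} → C.X, T (E.symm (θ, η)) := by
      refine le_trans (mul_le_mul_of_nonneg_left ?_ (by positivity)) h1
      push_cast
      nlinarith
    refine le_of_mul_le_mul_right ?_ (show 0 < Real.log 2 / 2 by linarith)
    calc (2 : ℝ) ^ (C.b * 2 ^ ν) * (C.b * 2 ^ ν) * (Real.log 2 / 2)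
        = (2 : ℝ) ^ (C.b * 2 ^ ν) * ((C.b * 2 ^ ν) * Real.log 2 / 2) := by ring
      _ ≤ _ := h4
      _ = _ := by ring
  calc (Fintype.card (Fin (n / C.L) → C.X) : ℝ) * (C.b * 2 ^ ν)
      = ∑ _η : {i // ¬ p i} → C.X,
          (Fintype.card ({i // p i} → C.X) : ℝ) * (C.b * 2 ^ ν) := by
        rw [Fintype.card_congr E, Fintype.card_prod, Finset.sum_const, Finset.card_univ,
          nsmul_eq_mul]
        push_cast
        ring
    _ ≤ ∑ η : {i // ¬ p i} → C.X, 4 * w * ∑ θ : {i // p i} → C.X, T (E.symm (θ, η)) :=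
        Finset.sum_le_sum fun η _ => hone η
    _ = 4 * w * ∑ ω, T ω := by
        rw [← Finset.mul_sum, ← Equiv.sum_comp E.symm T, Fintype.sum_prod_type_right]

/-- Groups of rows at all scales charge disjoint sets of probes. -/
theorem sum_transfer_le_totalProbes {n w a z : ℕ} (A : Algorithm w (Fin q) n)
    (U : Fin n → Fin q) :
    ∑ ν ∈ Finset.Ico a z, ∑ g ∈ Finset.range (n / C.L / (8 * 2 ^ ν)),
      (A.transfer U (C.L * (8 * 2 ^ ν * g)) (C.L * (8 * 2 ^ ν * g + 4 * 2 ^ ν))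
        (C.L * (8 * 2 ^ ν * (g + 1)))).card ≤ A.totalProbes U := by
  have hL := C.L_pos
  rw [Finset.sum_sigma']
  refine A.sum_card_transfer_le U _ (fun x : (_ : ℕ) × ℕ => C.L * (8 * 2 ^ x.1 * x.2))
    (fun x => C.L * (8 * 2 ^ x.1 * x.2 + 4 * 2 ^ x.1)) (fun x => C.L * (8 * 2 ^ x.1 * (x.2 + 1)))
    (fun x => Nat.mul_le_mul_left _ (by omega)) ?_
  -- At a larger scale the borders of the halves are multiples of the smaller group size.
  have key : ∀ ν g ν' g' t : ℕ, ν < ν' → t < C.L * (8 * 2 ^ ν * (g + 1)) →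
      C.L * (8 * 2 ^ ν' * g' + 4 * 2 ^ ν') ≤ t →
      C.L * (8 * 2 ^ ν' * g' + 4 * 2 ^ ν') ≤ C.L * (8 * 2 ^ ν * g) := by
    intro ν g ν' g' t hν h1 h2
    obtain ⟨d, rfl⟩ := Nat.exists_eq_add_of_lt hν
    have h3 : 8 * 2 ^ (ν + d + 1) * g' + 4 * 2 ^ (ν + d + 1) =
        8 * 2 ^ ν * (2 ^ d * (2 * g' + 1)) := by ring
    rw [h3] at h2 ⊢
    have h4 := lt_of_mul_lt_mul_left (h2.trans_lt h1) (Nat.zero_le _)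
    have h5 := lt_of_mul_lt_mul_left h4 (Nat.zero_le _)
    exact Nat.mul_le_mul_left _ (Nat.mul_le_mul_left _ (by omega))
  rintro ⟨ν, g⟩ _ ⟨ν', g'⟩ _ hne t h1 h2 h3 h4
  simp only at h1 h2 h3 h4 ⊢
  rcases lt_trichotomy ν ν' with h | h | h
  · exact Or.inr (key ν g ν' g' t h h2 h3)
  · subst h
    exfalso
    have h5 : C.L * (8 * 2 ^ ν * g) < C.L * (8 * 2 ^ ν * (g' + 1)) :=
      lt_of_le_of_lt ((Nat.mul_le_mul_left _ (by omega)).trans h1) h4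
    have h6 : C.L * (8 * 2 ^ ν * g') < C.L * (8 * 2 ^ ν * (g + 1)) :=
      lt_of_le_of_lt ((Nat.mul_le_mul_left _ (by omega)).trans h3) h2
    have h7 := lt_of_mul_lt_mul_left (lt_of_mul_lt_mul_left h5 (Nat.zero_le _)) (Nat.zero_le _)
    have h8 := lt_of_mul_lt_mul_left (lt_of_mul_lt_mul_left h6 (Nat.zero_le _)) (Nat.zero_le _)
    exact hne (by rw [show g = g' by omega])
  · exact Or.inl (key ν' g' ν g t h h4 h1)

theorem le_sum_totalProbes {n w a z : ℕ} (ha : 3 ≤ a) (hH : C.H ≤ 2 ^ a)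
    (hz : 2 ^ (z + 2) ≤ n / C.L) (S₀ : Fin n → Fin q) (A : Algorithm w (Fin q) n)
    (hA : A.SolvesHamming (C.fixedString n) S₀) :
    (Fintype.card (Fin (n / C.L) → C.X) : ℝ) * ((z - a : ℕ) * (C.b * (n / C.L : ℕ))) ≤
      64 * w * ∑ ω : Fin (n / C.L) → C.X,
        (A.totalProbes (fun i => C.updates n ω i) : ℝ) := by
  set M := n / C.L with hM
  set D : ℝ := (Fintype.card (Fin M → C.X) : ℝ) with hD
  set T : (Fin M → C.X) → ℕ → ℕ → ℝ := fun ω ν g =>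
    ((A.transfer (fun i => C.updates n ω i) (C.L * (8 * 2 ^ ν * g))
      (C.L * (8 * 2 ^ ν * g + 4 * 2 ^ ν)) (C.L * (8 * 2 ^ ν * (g + 1)))).card : ℝ) with hT
  have h1 : ∀ ν ∈ Finset.Ico a z, D * (C.b * M) ≤
      ∑ g ∈ Finset.range (M / (8 * 2 ^ ν)), 16 * (D * (C.b * 2 ^ ν)) := by
    intro ν hν
    rw [Finset.mem_Ico] at hν
    have h2 : 2 ^ (ν + 3) ≤ M := (Nat.pow_le_pow_right (by norm_num) (by omega)).trans hz
    have h3 : 8 * 2 ^ ν ≤ M := by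
      rw [pow_add] at h2
      omega
    have h4 : M ≤ M / (8 * 2 ^ ν) * (16 * 2 ^ ν) := by
      have h5 : 1 ≤ M / (8 * 2 ^ ν) := (Nat.one_le_div_iff (by positivity)).2 h3
      have h6 := Nat.div_add_mod M (8 * 2 ^ ν)
      have h7 := Nat.mod_lt M (show 0 < 8 * 2 ^ ν by positivity)
      nlinarith
    rw [Finset.sum_const, Finset.card_range, nsmul_eq_mul]
    have h5 : (M : ℝ) ≤ (M / (8 * 2 ^ ν) : ℕ) * (16 * 2 ^ ν) := by exact_mod_cast h4
    calc D * (C.b * M) ≤ D * (C.b * ((M / (8 * 2 ^ ν) : ℕ) * (16 * 2 ^ ν))) := by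
          rw [hD]
          gcongr
      _ = _ := by ring
  calc D * ((z - a : ℕ) * (C.b * M)) = ∑ ν ∈ Finset.Ico a z, D * (C.b * M) := by
        rw [Finset.sum_const, Nat.card_Ico, nsmul_eq_mul]
        ring
    _ ≤ ∑ ν ∈ Finset.Ico a z, ∑ g ∈ Finset.range (M / (8 * 2 ^ ν)), 16 * (D * (C.b * 2 ^ ν)) :=
        Finset.sum_le_sum h1
    _ ≤ ∑ ν ∈ Finset.Ico a z, ∑ g ∈ Finset.range (M / (8 * 2 ^ ν)),
          16 * (4 * w * ∑ ω, T ω ν g) := by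
        refine Finset.sum_le_sum fun ν hν => Finset.sum_le_sum fun g hg => ?_
        rw [Finset.mem_Ico] at hν
        rw [Finset.mem_range] at hg
        refine mul_le_mul_of_nonneg_left ?_ (by norm_num)
        refine C.le_sum_card_transfer (hH.trans (Nat.pow_le_pow_right (by norm_num) hν.1))
          (ha.trans hν.1) ?_ S₀ A hA
        rw [mul_comm]
        exact (Nat.le_div_iff_mul_le (by positivity)).1 hg
    _ = 64 * w * ∑ ω, ∑ ν ∈ Finset.Ico a z, ∑ g ∈ Finset.range (M / (8 * 2 ^ ν)), T ω ν g := by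
        rw [Finset.sum_comm, Finset.mul_sum]
        refine Finset.sum_congr rfl fun ν _ => ?_
        rw [Finset.sum_comm, Finset.mul_sum]
        refine Finset.sum_congr rfl fun g _ => ?_
        ring
    _ ≤ 64 * w * ∑ ω, (A.totalProbes (fun i => C.updates n ω i) : ℝ) := by
        refine mul_le_mul_of_nonneg_left (Finset.sum_le_sum fun ω _ => ?_) (by positivity)
        have := C.sum_transfer_le_totalProbes (a := a) (z := z) A (fun i => C.updates n ω i)
        simp only [hT]
        exact_mod_cast this

end SlidingCode


/-! ### From total counts to expectations -/

theorem tsum_map_mul {α β : Type*} (p : PMF α) (f : α → β) (g : β → ℝ≥0∞) :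
    ∑' U, p.map f U * g U = ∑' a, p a * g (f a) := by
  classical
  simp_rw [PMF.map_apply, ← ENNReal.tsum_mul_right]
  rw [ENNReal.tsum_comm]
  refine tsum_congr fun a => ?_
  rw [tsum_eq_single (f a)]
  · simp
  · intro U hU
    simp [hU]

theorem le_amortisedProbes_map_uniform {w m : ℕ} {σ Ω : Type} [Fintype Ω] [Nonempty Ω]
    (hm : 0 < m) (A : Algorithm w σ m) (f : Ω → Fin m → σ) {r : ℝ}
    (h : r * m * Fintype.card Ω ≤ ∑ ω, (A.totalProbes (f ω) : ℝ)) :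
    ENNReal.ofReal r ≤ amortisedProbes A ((PMF.uniformOfFintype Ω).map f) := by
  unfold amortisedProbes
  rw [tsum_map_mul _ f fun U => (A.totalProbes U : ℝ≥0∞)]
  simp_rw [PMF.uniformOfFintype_apply, ENNReal.tsum_mul_left, tsum_fintype]
  rw [ENNReal.le_div_iff_mul_le (Or.inl (by exact_mod_cast hm.ne')) (Or.inl (by simp)), mul_comm
    (_⁻¹), ← div_eq_mul_inv,
    ENNReal.le_div_iff_mul_le (Or.inl (by simp)) (Or.inl (by simp)),
    ← ENNReal.ofReal_natCast m, ← ENNReal.ofReal_natCast (Fintype.card Ω),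
    ← ENNReal.ofReal_mul' (by positivity), ← ENNReal.ofReal_mul' (by positivity)]
  refine (ENNReal.ofReal_le_ofReal h).trans (le_of_eq ?_)
  rw [ENNReal.ofReal_sum_of_nonneg fun _ _ => by positivity]
  simp

/-- The averaging direction of Yao's principle: a bound for all deterministic algorithms on a
distribution of inputs is attained by any randomised algorithm on some input. -/
theorem exists_le_randomisedAmortisedProbes {w m : ℕ} {σ : Type} [Finite σ]
    (μ : PMF (Fin m → σ)) (ν : PMF (Algorithm w σ m)) {B : ℝ≥0∞}
    (h : ∀ A ∈ ν.support, B ≤ amortisedProbes A μ) :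
    ∃ U, B ≤ randomisedAmortisedProbes ν U := by
  obtain ⟨U₀, -⟩ := μ.support_nonempty
  have : Nonempty (Fin m → σ) := ⟨U₀⟩
  obtain ⟨U, hU⟩ := Finite.exists_max fun U => randomisedAmortisedProbes ν U
  refine ⟨U, ?_⟩
  calc B = ∑' A, ν A * B := by rw [ENNReal.tsum_mul_right, ν.tsum_coe, one_mul]
    _ ≤ ∑' A, ν A * amortisedProbes A μ := by
        refine ENNReal.tsum_le_tsum fun A => ?_
        by_cases hA : A ∈ ν.support
        · exact mul_le_mul_right (h A hA) _
        · rw [PMF.mem_support_iff, not_not] at hA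
          simp [hA]
    _ = ∑' V, μ V * randomisedAmortisedProbes ν V := by
        simp only [amortisedProbes, randomisedAmortisedProbes, div_eq_mul_inv]
        simp_rw [← mul_assoc, ← ENNReal.tsum_mul_left, ← ENNReal.tsum_mul_right]
        rw [ENNReal.tsum_comm]
        refine tsum_congr fun V => tsum_congr fun A => ?_
        ring
    _ ≤ ∑' V, μ V * randomisedAmortisedProbes ν U :=
        ENNReal.tsum_le_tsum fun V => mul_le_mul_right (hU V) _
    _ = randomisedAmortisedProbes ν U := by rw [ENNReal.tsum_mul_right, μ.tsum_coe, one_mul]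

/-! ### Short strings -/

theorem Program.run_fst_of_probes_eq_zero {w : ℕ} {α : Type} (p : Program w α) (M N : Memory w)
    (h : (p.run M).2.2 = 0) : (p.run M).1 = (p.run N).1 := by
  cases p with
  | ret a => rfl
  | read addr next => simp [run] at h
  | write addr value next => simp [run] at h

/-- Without any probe, the output at the second arrival cannot take the first arrival into
account. -/
theorem one_le_totalProbes_add {w n q : ℕ} [NeZero q] (hq : 2 ≤ q) (hn : 2 ≤ n)
    (S₀ : Fin n → Fin q) (A : Algorithm w (Fin q) n) (hA : A.SolvesHamming (fun _ => 0) S₀) :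
    1 ≤ A.totalProbes (fun _ => 0) +
      A.totalProbes (fun i => if (i : ℕ) = 0 then Fin.ofNat q 1 else 0) := by
  by_contra hcon
  have h01 : Fin.ofNat q 1 ≠ 0 := by
    intro h
    have := congrArg Fin.val h
    simp [Nat.mod_eq_of_lt (show 1 < q by omega)] at this
  generalize Fin.ofNat q 1 = one at *
  set u : ℕ → Fin q := fun _ => 0 with hu
  set v : ℕ → Fin q := fun i => if i = 0 then one else 0 with hv
  have h1 : A.totalProbes (fun i => u i) = 0 := by
    simp only [hu]
    omega
  set t : Fin n := ⟨1, by omega⟩ with ht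
  have h3 : A.probes (fun i => u i) t = 0 := Finset.sum_eq_zero_iff.1 h1 t (Finset.mem_univ _)
  have h4 : A.output (fun i => u i) t = A.output (fun i => v i) t :=
    Program.run_fst_of_probes_eq_zero (A.op t 0) _ _ h3
  rw [hA, hA] at h4
  obtain ⟨c, hc⟩ := exists_hammingDist_add_eq (fun _ => (0 : Fin q)) S₀ t
  have h5 := hc u
  have h6 := hc v
  rw [h4] at h5
  have h7 := h5.trans h6.symm
  simp [ht, hu, hv, Finset.range_add_one, Finset.filter_insert, Finset.filter_singleton,
    h01.symm] at h7

/-! ### The lower bound -/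

/-- For `n < 2 ^ 73` the claimed bound is at most `38 / 2 ^ 80` probes per arrival, because
`log n ≤ w` and `δ ≤ 38`. It follows from a single probe on one of two equally likely update
sequences. -/
theorem exists_lower_bound_short {n δ : ℕ} (hn : 2 ≤ n) (hδ : 1 ≤ δ) (hnδ : (2 ^ δ - 1) ^ 2 ≤ n)
    (hlog : Nat.log 2 n < 73) :
    ∃ (F : Fin n → Fin (2 ^ δ)) (μ : PMF (Fin n → Fin (2 ^ δ))),
      ∀ w : ℕ, n ≤ 2 ^ w → ∀ S₀ : Fin n → Fin (2 ^ δ),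
        ∀ A : Algorithm w (Fin (2 ^ δ)) n, A.SolvesHamming F S₀ →
          ENNReal.ofReal ((2⁻¹) ^ 80 * ((δ : ℝ) / (w : ℝ)) * Real.logb 2 (n : ℝ))
            ≤ amortisedProbes A μ := by
  refine ⟨fun _ => 0, (PMF.uniformOfFintype Bool).map fun b i =>
    if b = true ∧ (i : ℕ) = 0 then Fin.ofNat (2 ^ δ) 1 else 0, fun w hw S₀ A hA => ?_⟩
  refine le_amortisedProbes_map_uniform (by omega) A _ ?_
  have hq : 2 ≤ 2 ^ δ := by simpa using Nat.pow_le_pow_right (n := 2) (by norm_num) hδ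
  have h1 := one_le_totalProbes_add hq hn S₀ A hA
  have hn73 : n < 2 ^ 73 := Nat.lt_pow_of_log_lt (by norm_num) hlog
  have hδ' : δ ≤ 38 := by
    by_contra hcon
    have h2 : 2 ^ 39 ≤ 2 ^ δ := Nat.pow_le_pow_right (by norm_num) (by omega)
    have h3 : (2 ^ 39 - 1) ^ 2 ≤ (2 ^ δ - 1) ^ 2 := Nat.pow_le_pow_left (by omega) 2
    norm_num at h3 hn73
    omega
  have hw1 : 0 < w := by
    rcases Nat.eq_zero_or_pos w with h | h
    · rw [h] at hw
      omega
    · exact h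
  have hlogw : Real.logb 2 n ≤ w := by
    rw [Real.logb_le_iff_le_rpow (by norm_num) (by positivity), Real.rpow_natCast]
    exact_mod_cast hw
  have hw0 : (0 : ℝ) < w := by exact_mod_cast hw1
  have h2 : (2⁻¹ : ℝ) ^ 80 * ((δ : ℝ) / w) * Real.logb 2 n ≤ 2⁻¹ ^ 80 * 38 := by
    have h3 : (δ : ℝ) / w * Real.logb 2 n ≤ δ / w * w :=
      mul_le_mul_of_nonneg_left hlogw (by positivity)
    rw [div_mul_cancel₀ _ hw0.ne'] at h3
    have h4 : (δ : ℝ) ≤ 38 := by exact_mod_cast hδ'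
    rw [mul_assoc]
    exact mul_le_mul_of_nonneg_left (h3.trans h4) (by positivity)
  have h5 : (n : ℝ) ≤ 2 ^ 73 := by exact_mod_cast hn73.le
  calc (2⁻¹ : ℝ) ^ 80 * ((δ : ℝ) / w) * Real.logb 2 n * n * Fintype.card Bool
      ≤ 2⁻¹ ^ 80 * 38 * 2 ^ 73 * 2 := by
        rw [Fintype.card_bool]
        push_cast
        gcongr
    _ ≤ 1 := by norm_num
    _ ≤ _ := by
        rw [Fintype.sum_bool]
        simp only [true_and, Bool.false_eq_true, false_and, if_false]
        rw [add_comm]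
        exact_mod_cast h1

/-- For long strings a constant fraction of all scales contributes: rows and pattern are shorter
than `2 ^ 6 * n ^ (1 / 4)`, and the scales in between that and `n` are used. The constant is the one
needed for short strings. -/
theorem exists_lower_bound_long {n δ : ℕ} (hδ : 1 ≤ δ) (hnδ : (2 ^ δ - 1) ^ 2 ≤ n)
    (hlog : 73 ≤ Nat.log 2 n) :
    ∃ (F : Fin n → Fin (2 ^ δ)) (μ : PMF (Fin n → Fin (2 ^ δ))),
      ∀ w : ℕ, n ≤ 2 ^ w → ∀ S₀ : Fin n → Fin (2 ^ δ),
        ∀ A : Algorithm w (Fin (2 ^ δ)) n, A.SolvesHamming F S₀ →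
          ENNReal.ofReal ((2⁻¹) ^ 80 * ((δ : ℝ) / (w : ℝ)) * Real.logb 2 (n : ℝ))
            ≤ amortisedProbes A μ := by
  obtain ⟨C, hrate, hsize⟩ := exists_slidingCode δ hδ
  have hL := C.L_pos
  have hH := C.H_pos
  have hn : n ≠ 0 := by
    rintro rfl
    simp at hlog
  set l := Nat.log 2 n with hl
  set s := Nat.log 2 (C.L * C.H) with hs
  have hln : 2 ^ l ≤ n := Nat.pow_log_le_self 2 hn
  have hnl : n < 2 ^ (l + 1) := Nat.lt_pow_succ_log_self (by norm_num) n
  have hLHs : C.L * C.H < 2 ^ (s + 1) := Nat.lt_pow_succ_log_self (by norm_num) _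
  have hsLH : 2 ^ s ≤ C.L * C.H := Nat.pow_log_le_self 2 (by positivity)
  have hδl : 2 * δ ≤ l + 2 := by
    obtain ⟨d, rfl⟩ := Nat.exists_eq_add_of_le hδ
    have h1 : 2 ^ d ≤ 2 ^ (1 + d) - 1 := by
      have := Nat.one_le_two_pow (n := d)
      rw [pow_add]
      omega
    have h2 : 2 ^ (2 * d) < 2 ^ (l + 1) := by
      calc 2 ^ (2 * d) = (2 ^ d) ^ 2 := by rw [← pow_mul, mul_comm]
        _ ≤ (2 ^ (1 + d) - 1) ^ 2 := Nat.pow_le_pow_left h1 2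
        _ ≤ n := hnδ
        _ < 2 ^ (l + 1) := hnl
    have := (Nat.pow_lt_pow_iff_right (by norm_num)).1 h2
    omega
  have hsδ : 2 * s ≤ δ + 10 := by
    have h1 : 2 ^ (2 * s) ≤ 2 ^ (δ + 10) := by
      calc 2 ^ (2 * s) = (2 ^ s) ^ 2 := by rw [← pow_mul, mul_comm]
        _ ≤ (C.L * C.H) ^ 2 := Nat.pow_le_pow_left hsLH 2
        _ ≤ _ := hsize
    exact (Nat.pow_le_pow_iff_right (by norm_num)).1 h1
  have hLs : C.L ≤ 2 ^ (s + 1) := (Nat.le_mul_of_pos_right _ hH).trans hLHs.le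
  have hHs : C.H ≤ 2 ^ (s + 1) := (Nat.le_mul_of_pos_left _ hL).trans hLHs.le
  have hrows : 2 ^ (l - s - 1) ≤ n / C.L := by
    rw [Nat.le_div_iff_mul_le hL]
    calc 2 ^ (l - s - 1) * C.L ≤ 2 ^ (l - s - 1) * 2 ^ (s + 1) := Nat.mul_le_mul_left _ hLs
      _ = 2 ^ l := by rw [← pow_add]; congr 1; omega
      _ ≤ n := hln
  have hM : n ≤ 2 * (C.L * (n / C.L)) := by
    have h1 : 1 ≤ n / C.L := Nat.one_le_two_pow.trans hrows
    have h2 := Nat.div_add_mod n C.L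
    have h3 := Nat.mod_lt n hL
    have h4 : C.L ≤ C.L * (n / C.L) := Nat.le_mul_of_pos_right _ h1
    omega
  refine ⟨C.fixedString n, (PMF.uniformOfFintype (Fin (n / C.L) → C.X)).map
    fun ω i => C.updates n ω i, fun w hw S₀ A hA => ?_⟩
  refine le_amortisedProbes_map_uniform (Nat.pos_of_ne_zero hn) A _ ?_
  -- The least scale exceeds pattern and row length, and the largest group has at most `n / C.L`
  -- rows.
  have hmain := C.le_sum_totalProbes (a := s + 3) (z := l - s - 3) (by omega)
    (hHs.trans (Nat.pow_le_pow_right (by norm_num) (by omega)))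
    ((Nat.pow_le_pow_right (by norm_num) (by omega)).trans hrows) S₀ A hA
  set D : ℝ := (Fintype.card (Fin (n / C.L) → C.X) : ℝ) with hD
  set T : ℝ := ∑ ω : Fin (n / C.L) → C.X, (A.totalProbes (fun i => C.updates n ω i) : ℝ) with hT
  have hw1 : 0 < w := by
    rcases Nat.eq_zero_or_pos w with h | h
    · rw [h] at hw
      have : n = 1 := by omega
      rw [hl, this] at hlog
      simp at hlog
    · exact h
  have hw0 : (0 : ℝ) < w := by exact_mod_cast hw1
  have hlogn : Real.logb 2 n ≤ l + 1 := by
    rw [Real.logb_le_iff_le_rpow (by norm_num) (by positivity)]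
    have : (n : ℝ) ≤ 2 ^ (l + 1) := by exact_mod_cast hnl.le
    exact_mod_cast this
  have hscales : l + 1 ≤ 8 * (l - s - 3 - (s + 3)) := by omega
  have hscales' : (l : ℝ) + 1 ≤ 8 * (l - s - 3 - (s + 3) : ℕ) := by exact_mod_cast hscales
  have hinfo : δ * n ≤ 256 * (C.b * (n / C.L)) := by
    calc δ * n ≤ δ * (2 * (C.L * (n / C.L))) := Nat.mul_le_mul_left _ hM
      _ = 2 * (C.L * δ) * (n / C.L) := by ring
      _ ≤ 2 * (128 * C.b) * (n / C.L) := by gcongr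
      _ = 256 * (C.b * (n / C.L)) := by ring
  have hinfo' : (δ : ℝ) * n ≤ 256 * (C.b * (n / C.L : ℕ)) := by exact_mod_cast hinfo
  have hprod : (δ : ℝ) * n * Real.logb 2 n * D ≤
      2048 * (D * ((l - s - 3 - (s + 3) : ℕ) * (C.b * (n / C.L : ℕ)))) := by
    calc (δ : ℝ) * n * Real.logb 2 n * D
        ≤ 256 * (C.b * (n / C.L : ℕ)) * (8 * (l - s - 3 - (s + 3) : ℕ)) * D := by
          refine mul_le_mul_of_nonneg_right ?_ (by positivity)
          exact mul_le_mul hinfo' (hlogn.trans hscales')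
            (Real.logb_nonneg (by norm_num) (by exact_mod_cast Nat.pos_of_ne_zero hn))
            (by positivity)
      _ = _ := by ring
  have hTnn : 0 ≤ T := by positivity
  calc (2⁻¹ : ℝ) ^ 80 * ((δ : ℝ) / w) * Real.logb 2 n * n * D
      = 2⁻¹ ^ 80 * ((δ : ℝ) * n * Real.logb 2 n * D) / w := by ring
    _ ≤ 2⁻¹ ^ 80 * (2048 * (64 * w * T)) / w := by
        refine div_le_div_of_nonneg_right (mul_le_mul_of_nonneg_left ?_ (by positivity)) hw0.le
        exact hprod.trans (mul_le_mul_of_nonneg_left hmain (by norm_num))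
    _ = 2⁻¹ ^ 80 * 131072 * T := by field_simp; ring
    _ ≤ 1 * T := mul_le_mul_of_nonneg_right (by norm_num) hTnn
    _ = T := one_mul T

end CellProbe

theorem theorem1 :
    ∃ c : ℝ, 0 < c ∧ ∀ n δ : ℕ, 1 ≤ n → 1 ≤ δ → (2 ^ δ - 1) ^ 2 ≤ n →
      ∃ (F : Fin n → Fin (2 ^ δ)) (μ : PMF (Fin n → Fin (2 ^ δ))),
        ∀ w : ℕ, n ≤ 2 ^ w → ∀ S₀ : Fin n → Fin (2 ^ δ),
          (∀ A : CellProbe.Algorithm w (Fin (2 ^ δ)) n, A.SolvesHamming F S₀ →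
            ENNReal.ofReal (c * ((δ : ℝ) / (w : ℝ)) * Real.logb 2 (n : ℝ))
              ≤ CellProbe.amortisedProbes A μ) ∧
          (∀ ν : PMF (CellProbe.Algorithm w (Fin (2 ^ δ)) n),
            (∀ A ∈ ν.support, A.SolvesHamming F S₀) →
              ∃ U : Fin n → Fin (2 ^ δ),
                ENNReal.ofReal (c * ((δ : ℝ) / (w : ℝ)) * Real.logb 2 (n : ℝ))
                  ≤ CellProbe.randomisedAmortisedProbes ν U) := by
  refine ⟨2⁻¹ ^ 80, by positivity, fun n δ hn hδ hnδ => ?_⟩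
  have key : ∃ (F : Fin n → Fin (2 ^ δ)) (μ : PMF (Fin n → Fin (2 ^ δ))),
      ∀ w : ℕ, n ≤ 2 ^ w → ∀ S₀ : Fin n → Fin (2 ^ δ),
        ∀ A : CellProbe.Algorithm w (Fin (2 ^ δ)) n, A.SolvesHamming F S₀ →
          ENNReal.ofReal ((2⁻¹) ^ 80 * ((δ : ℝ) / (w : ℝ)) * Real.logb 2 (n : ℝ))
            ≤ CellProbe.amortisedProbes A μ := by
    rcases hn.eq_or_lt with rfl | hn
    · exact ⟨fun _ => 0, PMF.pure fun _ => 0, fun w _ S₀ A _ => by simp⟩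
    · by_cases hlog : Nat.log 2 n < 73
      · exact CellProbe.exists_lower_bound_short hn hδ hnδ hlog
      · exact CellProbe.exists_lower_bound_long hδ hnδ (not_lt.1 hlog)
  obtain ⟨F, μ, h⟩ := key
  exact ⟨F, μ, fun w hw S₀ => ⟨h w hw S₀, fun ν hν =>
    CellProbe.exists_le_randomisedAmortisedProbes μ ν fun A hA => h w hw S₀ A (hν A hA)⟩⟩
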